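/- Let $n\ge 2$, $0\le l\le m$, let $d$ be a positive even integer, and let $f_1,\dots,f_m,g\in\mathbb{R}[x_1,\dots,x_n]$ have degree at most $d$. Let $q_0=n+1$, let $q_1<\dots<q_m$ be the first $m$ primes greater than $n+1$, and put $a_{ij}=\frac{1}{q_i-j}$ for $0\le i\le m$, $0\le j\le n$. With $T_d$ the Chebyshev polynomial (of the first kind) of degree $d$, put $$\tilde g=\sum_{j=1}^n a_{0j}T_d(x_j),\qquad \tilde f_i=a_{i0}+\sum_{j=1}^n a_{ij}\big(T_d(x_j)+1\big)\quad(1\le i\le m),$$ $$G(t,x)=t\,g(x)+(1-t)\,\tilde g(x),\qquad F_i^{\pm}(t,x)=t\,f_i(x)\pm(1-t)\,\tilde f_i(x).$$ For $S\subset\{1,\dots,m\}$ and $\sigma\in\{+,-\}^S$ let $$\hat V_{S,\sigma}=\Big\{(t,x,\lambda)\in\mathbb{A}^1_{\mathbb{C}}\times\mathbb{A}^n_{\mathbb{C}}\times\mathbb{P}^{|S|}_{\mathbb{C}}\ \Big|\ F_i^{\sigma_i}(t,x)=0\ \text{for all } i\in S,\ \ \lambda_0\nabla_xG(t,x)=\sum_{i\in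 S}\lambda_i\nabla_xF_i^{\sigma_i}(t,x)\Big\},$$ and let $V_{S,\sigma}$ be the union of those irreducible components of $\hat V_{S,\sigma}$ (in the Zariski topology) that are not contained in $\{t=t_0\}$ for any $t_0\in\mathbb{C}$. Let $\mathcal{S}$ be the set of all pairs $(S,\sigma)$ with $S\subset\{1,\dots,m\}$, $|S|\le n$ and $\sigma\in\{+,-\}^S$ such that $\sigma_i=+$ for every $i\in S$ with $i\ge l+1$, and let $\Pi_x$ denote the projection $(t,x,\lambda)\mapsto x$. Then, for every $(S,\sigma)\in\mathcal{S}$, every irreducible component of $V_{S,\sigma}$ has dimension $1$ and meets $\{t=0\}$, and the set $\Pi_x(V_{S,\sigma}\cap\{t=1\})$ is finite. -/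

import Mathlib

namespace Deformation

/-! ### The Zariski topology on `𝔸¹ × 𝔸ⁿ × ℙˢ` -/

/-- The closed points `(t, x, λ)` of the complex variety `𝔸¹ × 𝔸ⁿ × ℙˢ`, where `s` is the number of
elements of `ι`. The homogeneous coordinates `(λ₀, (λ_i)_{i ∈ ι})` are indexed by `Option ι`, with
`none` for the index `0`. -/
@[ext]
structure MixedSpace (n : ℕ) (ι : Type) where
  t : ℂ
  x : Fin n → ℂ
  lam : Projectivization ℂ (Option ι → ℂ)

/-- The variables `t, x₁, …, xₙ` (left summand) and `λ₀, (λ_i)_{i ∈ ι}` (right summand). -/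
abbrev Vars (n : ℕ) (ι : Type) : Type := Option (Fin n) ⊕ Option ι

/-- `F ∈ ℂ[t, x, λ]` is homogeneous of some degree in the variables `λ`. -/
def IsLamHomogeneous {n : ℕ} {ι : Type} (F : MvPolynomial (Vars n ι) ℂ) : Prop :=
  ∃ k : ℕ, F.IsWeightedHomogeneous (Sum.elim (fun _ => 0) (fun _ => 1) : Vars n ι → ℕ) k

namespace MixedSpace

variable {n : ℕ} {ι : Type}

/-- Coordinates of a point, for a chosen representative of `λ`. Only conditions that are invariant
under rescaling `λ` are ever imposed on them. -/
noncomputable def coords (p : MixedSpace n ι) : Vars n ι → ℂ :=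
  Sum.elim (fun o => o.elim p.t p.x) p.lam.rep

/-- The common zeros of a set of polynomials (used for polynomials homogeneous in `λ`). -/
def zeroLocus (P : Set (MvPolynomial (Vars n ι) ℂ)) : Set (MixedSpace n ι) :=
  {p | ∀ F ∈ P, MvPolynomial.eval p.coords F = 0}

/-- Zariski closed sets: the zero loci of sets of polynomials that are homogeneous in `λ`. -/
def IsZariskiClosed (Z : Set (MixedSpace n ι)) : Prop :=
  ∃ P : Set (MvPolynomial (Vars n ι) ℂ), (∀ F ∈ P, IsLamHomogeneous F) ∧ Z = zeroLocus P

theorem isZariskiClosed_empty : IsZariskiClosed (∅ : Set (MixedSpace n ι)) := by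
  refine ⟨{1}, ?_, ?_⟩
  · rintro F rfl
    exact ⟨0, MvPolynomial.isWeightedHomogeneous_one _ _⟩
  · ext p
    simp [zeroLocus]

theorem isZariskiClosed_sInter (A : Set (Set (MixedSpace n ι)))
    (hA : A ⊆ {Z | IsZariskiClosed Z}) : IsZariskiClosed (⋂₀ A) := by
  refine ⟨{F | IsLamHomogeneous F ∧ ∃ Z ∈ A, ∀ p ∈ Z, MvPolynomial.eval p.coords F = 0},
    fun F hF => hF.1, ?_⟩
  ext p
  constructor
  · rintro hp F ⟨-, Z, hZ, h⟩
    exact h p (hp Z hZ)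
  · intro hp Z hZ
    obtain ⟨P, hP, rfl⟩ := hA hZ
    intro F hF
    exact hp F ⟨hP F hF, zeroLocus P, hZ, fun q hq => hq F hF⟩

theorem isZariskiClosed_union (Z W : Set (MixedSpace n ι)) (hZ : IsZariskiClosed Z)
    (hW : IsZariskiClosed W) : IsZariskiClosed (Z ∪ W) := by
  obtain ⟨P, hP, rfl⟩ := hZ
  obtain ⟨Q, hQ, rfl⟩ := hW
  refine ⟨{H | ∃ F ∈ P, ∃ K ∈ Q, H = F * K}, ?_, ?_⟩
  · rintro H ⟨F, hF, K, hK, rfl⟩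
    obtain ⟨a, ha⟩ := hP F hF
    obtain ⟨b, hb⟩ := hQ K hK
    exact ⟨a + b, ha.mul hb⟩
  · ext p
    constructor
    · rintro (hp | hp) H ⟨F, hF, K, hK, rfl⟩
      · simp [hp F hF]
      · simp [hp K hK]
    · intro hp
      by_contra hcon
      simp only [Set.mem_union, not_or, zeroLocus, Set.mem_ofPred_eq, not_forall] at hcon
      obtain ⟨⟨F, hF, hF0⟩, ⟨K, hK, hK0⟩⟩ := hcon
      have h := hp (F * K) ⟨F, hF, K, hK, rfl⟩
      rw [map_mul] at h
      exact (mul_ne_zero hF0 hK0) h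

/-- The Zariski topology. -/
instance zariskiTopology : TopologicalSpace (MixedSpace n ι) :=
  TopologicalSpace.ofClosed {Z | IsZariskiClosed Z} isZariskiClosed_empty
    isZariskiClosed_sInter (fun Z hZ W hW => isZariskiClosed_union Z W hZ hW)

/-- The irreducible components of a (closed) set `A`: its maximal irreducible subsets. -/
def components (A : Set (MixedSpace n ι)) : Set (Set (MixedSpace n ι)) :=
  {W | Maximal (fun Z => IsIrreducible Z ∧ Z ⊆ A) W}

end MixedSpace

/-! ### The deformation -/

/-- `q₀ = n + 1`, and `q₁ < q₂ < ⋯` are the prime numbers greater than `n + 1`. -/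
noncomputable def q (n : ℕ) : ℕ → ℕ
  | 0 => n + 1
  | i + 1 => Nat.nth (fun p => p.Prime ∧ n + 1 < p) i

/-- The Cauchy matrix `a_{ij} = 1 / (q_i - j)`, `0 ≤ i ≤ m`, `0 ≤ j ≤ n`. -/
noncomputable def cauchyMatrix (m n : ℕ) : Matrix (Fin (m + 1)) (Fin (n + 1)) ℚ :=
  Matrix.of fun i j => 1 / ((q n i : ℚ) - ((j : ℕ) : ℚ))

/-- The polynomial `T_d(x_j)`, where `T_d` is the Chebyshev polynomial of the first kind. -/
noncomputable def chebyshevVar (n d : ℕ) (j : Fin n) : MvPolynomial (Fin n) ℝ :=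
  Polynomial.aeval (MvPolynomial.X j) (Polynomial.Chebyshev.T ℝ (d : ℤ))

/-- `g̃ = ∑_{1 ≤ j ≤ n} a_{0j} T_d(x_j)`. The variable `x_j` has the index `j - 1` in `Fin n`. -/
noncomputable def gTilde (m n d : ℕ) : MvPolynomial (Fin n) ℝ :=
  ∑ j : Fin n, MvPolynomial.C (cauchyMatrix m n 0 j.succ : ℝ) * chebyshevVar n d j

/-- `f̃_i = a_{i0} + ∑_{1 ≤ j ≤ n} a_{ij} (T_d(x_j) + 1)`, `1 ≤ i ≤ m`. The polynomial `f̃_i` has the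
index `i - 1` in `Fin m`. -/
noncomputable def fTilde (m n d : ℕ) (i : Fin m) : MvPolynomial (Fin n) ℝ :=
  MvPolynomial.C (cauchyMatrix m n i.succ 0 : ℝ) +
    ∑ j : Fin n, MvPolynomial.C (cauchyMatrix m n i.succ j.succ : ℝ) * (chebyshevVar n d j + 1)

/-- `t p + ε (1 - t) p̃` as a polynomial in `x`, for a sign `ε` and a complex number `t`. -/
noncomputable def deform {n : ℕ} (ε : ℤˣ) (p pTilde : MvPolynomial (Fin n) ℝ) (t : ℂ) :
    MvPolynomial (Fin n) ℂ :=
  MvPolynomial.C t * MvPolynomial.map (algebraMap ℝ ℂ) p +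
    MvPolynomial.C (((ε : ℤ) : ℂ) * (1 - t)) * MvPolynomial.map (algebraMap ℝ ℂ) pTilde

/-- `G(t, ·) = t g + (1 - t) g̃`. -/
noncomputable def G (m d : ℕ) {n : ℕ} (g : MvPolynomial (Fin n) ℝ) (t : ℂ) :
    MvPolynomial (Fin n) ℂ :=
  deform 1 g (gTilde m n d) t

/-- `F_i^{ε}(t, ·) = t f_i + ε (1 - t) f̃_i`, for a sign `ε`. -/
noncomputable def F (d : ℕ) {m n : ℕ} (f : Fin m → MvPolynomial (Fin n) ℝ) (i : Fin m) (ε : ℤˣ)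
    (t : ℂ) : MvPolynomial (Fin n) ℂ :=
  deform ε (f i) (fTilde m n d i) t

/-- The variety `V̂_{S,σ} ⊆ 𝔸¹ × 𝔸ⁿ × ℙ^{|S|}` of all `(t, x, λ)` with `F_i^{σ_i}(t, x) = 0` for every
`i ∈ S` and `λ₀ ∇ₓ G(t, x) = ∑_{i ∈ S} λ_i ∇ₓ F_i^{σ_i}(t, x)`. -/
def VHat (d : ℕ) {m n : ℕ} (f : Fin m → MvPolynomial (Fin n) ℝ) (g : MvPolynomial (Fin n) ℝ)
    (S : Finset (Fin m)) (σ : S → ℤˣ) : Set (MixedSpace n S) :=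
  {p | (∀ i : S, MvPolynomial.eval p.x (F d f i (σ i) p.t) = 0) ∧
    ∀ j : Fin n,
      p.lam.rep none * MvPolynomial.eval p.x (MvPolynomial.pderiv j (G m d g p.t)) =
        ∑ i : S, p.lam.rep (some i) *
          MvPolynomial.eval p.x (MvPolynomial.pderiv j (F d f i (σ i) p.t))}

/-- `V_{S,σ}`: the union of the irreducible components of `V̂_{S,σ}` that are not included in
`{t = t₀}` for any `t₀ ∈ ℂ`. -/
def V (d : ℕ) {m n : ℕ} (f : Fin m → MvPolynomial (Fin n) ℝ) (g : MvPolynomial (Fin n) ℝ)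
    (S : Finset (Fin m)) (σ : S → ℤˣ) : Set (MixedSpace n S) :=
  ⋃₀ {W | W ∈ MixedSpace.components (VHat d f g S σ) ∧ ¬ ∃ t₀ : ℂ, ∀ p ∈ W, p.t = t₀}

/-- The set `𝒮` of all `(S, σ)` with `S ⊆ {1, …, m}`, `|S| ≤ n` and `σ ∈ {+, -}^S` such that
`σ_i = +` for `l + 1 ≤ i ≤ m`. The number `i ∈ {1, …, m}` is the element `i - 1` of `Fin m`. -/
def indexSet (n m l : ℕ) : Set (Σ S : Finset (Fin m), S → ℤˣ) :=
  {P | P.1.card ≤ n ∧ ∀ i : P.1, l + 1 ≤ ((i : Fin m) : ℕ) + 1 → P.2 i = 1}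

end Deformation

/-!
The system at `t = 0` is nondegenerate: it has only finitely many solutions, none of them at
infinity in `x`, and none of them with `λ_0 = 0`. The proof extracts from this a statement about
places. Let `K` be an extension field of `ℂ` and let `(t, x, λ)` be a solution of the critical
point equations with coordinates in `K`. At each valuation ring of `K` that contains `ℂ` and in
whose maximal ideal `t` lies, the coordinates `x_j` and the ratios `λ_i / λ_0` are integral
(`IsCritical.mem_valuationSubring`). For, if `x` had a pole, its homogeneous coordinates would
reduce to a nonzero solution of the leading forms of the system at `t = 0`, and the minors of the
Cauchy matrix exclude this (`eq_zero_of_cauchy`). Once `x` is integral, it reduces to an honest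
critical point at `t = 0`. There `T_d(x_j) = ±1` for each `j` whose column of the Cauchy matrix is
not orthogonal to the multipliers; since the nodes `q_i` are primes, the number of the remaining
columns must be `|S|`, and this forces `λ_0 ≠ 0` (`apply_none_ne_zero_of_cauchy`).

Let now `W` be an irreducible closed subset of `V̂_{S,σ}` on which `t` is not constant, and apply
this to its generic point, so that `K` is the function field of `W` and `t` is transcendental over
`ℂ`. An element of `K` that has no pole over `t = 0` is algebraic over `ℂ(t)`, because otherwise
some place would have both `t` and the inverse of that element in its maximal ideal. Hence `K` is
algebraic over `ℂ(t)` (`IsCurve.isAlgebraic`). So a function that vanishes on a proper closed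
subset of `W` but not on `W` satisfies an algebraic relation with each coordinate, by which the
coordinate takes finitely many values on that subset; the irreducible closed proper subsets of `W`
are thus points (`IsCurve.exists_eq_singleton`), and `W` has dimension one. Since `t` vanishes at
some place of `K`, and the generic point is integral there, it specializes to a point of `W` with
`t = 0` (`IsCurve.exists_t_eq_zero`); this replaces a properness argument for the projection to the
`t`-line.

The space is Noetherian, so there are finitely many components, and each of them meets `{t = 1}` in
a proper closed subset, hence in finitely many points.
-/

namespace Deformation

/-! ### Cauchy matrices -/

open Polynomial in
/-- A Cauchy matrix with at least as many rows as columns has trivial kernel: the vector `c` is read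
off from the interpolation polynomial whose partial fractions are the given sums, and this
polynomial has too many zeros. -/
theorem eq_zero_of_sum_div_sub_eq_zero {L ι κ : Type*} [Field L] [DecidableEq κ]
    {I : Finset ι} {J : Finset κ} {u : ι → L} {v : κ → L} (hu : Set.InjOn u I)
    (hv : Set.InjOn v J) (huv : ∀ i ∈ I, ∀ j ∈ J, u i ≠ v j) (hcard : J.card ≤ I.card)
    {c : κ → L} (hc : ∀ i ∈ I, ∑ j ∈ J, c j / (u i - v j) = 0) : ∀ j ∈ J, c j = 0 := by
  set r : κ → L := fun j => c j / Lagrange.nodalWeight J v j with hr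
  have hp : Lagrange.interpolate J v r = 0 := by
    refine Polynomial.eq_zero_of_degree_lt_of_eval_index_eq_zero (v := u) I hu
      ((Lagrange.degree_interpolate_lt r hv).trans_le (by exact_mod_cast hcard)) fun i hi => ?_
    rw [Lagrange.eval_interpolate_not_at_node r (huv i hi)]
    refine mul_eq_zero_of_right _ ((Finset.sum_congr rfl fun j hj => ?_).trans (hc i hi))
    have := Lagrange.nodalWeight_ne_zero hv hj
    rw [hr]
    field_simp
  intro j hj
  have h := Lagrange.eval_interpolate_at_node r hv hj
  rw [hp, eval_zero] at h
  exact (div_eq_zero_iff.1 h.symm).resolve_right (Lagrange.nodalWeight_ne_zero hv hj)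

open Polynomial in
/-- The partial fraction decomposition of `A / ∏ (X - u_i)`, for `A` of small degree. -/
theorem sum_nodalWeight_mul_eval_div {L ι : Type*} [Field L] [DecidableEq ι] {s : Finset ι}
    {u : ι → L} (hu : Set.InjOn u s) {A : L[X]} (hA : A.degree < s.card) {z : L}
    (hz : ∀ i ∈ s, z ≠ u i) :
    ∑ i ∈ s, Lagrange.nodalWeight s u i * A.eval (u i) / (z - u i) =
      A.eval z / ∏ i ∈ s, (z - u i) := by
  have h := Lagrange.eval_interpolate_not_at_node (fun i => A.eval (u i)) hz
  rw [← Lagrange.eq_interpolate hu hA, Lagrange.eval_nodal] at h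
  rw [h, mul_div_cancel_left₀ _ (Finset.prod_ne_zero_iff.2 fun i hi => sub_ne_zero.2 (hz i hi))]
  exact Finset.sum_congr rfl fun i _ => by rw [div_eq_mul_inv]; ring

theorem padicNorm_prod {p : ℕ} [Fact p.Prime] {α : Type*} (t : Finset α) (h : α → ℚ) :
    padicNorm p (∏ i ∈ t, h i) = ∏ i ∈ t, padicNorm p (h i) := by
  induction t using Finset.cons_induction with
  | empty => simp
  | cons a t ha ih => rw [Finset.prod_cons, Finset.prod_cons, padicNorm.mul, ih]

/-- `R(z) = ∏_{j ∈ J} (z - (j + 1)) / ∏_{i ∈ s} (z - Q_i)`. -/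
noncomputable def nodeQuotient {n : ℕ} {ι : Type*} (Q : ι → ℕ) (s : Finset ι)
    (J : Finset (Fin n)) (z : ℚ) : ℚ :=
  (∏ j ∈ J, (z - ((j : ℕ) + 1))) / ∏ i ∈ s, (z - Q i)

/-- Here the choice of primes as nodes enters. If `p` is the largest of the primes `Q_i`, `i ∈ s`,
then `R(0)` has `p`-adic norm `p`, while the values of `R` at the columns are `p`-integral. -/
theorem nodeQuotient_ne {n : ℕ} {ι : Type*} {Q : ι → ℕ} (hQ : Function.Injective Q)
    (hp : ∀ i, (Q i).Prime) (hn : ∀ i, n < Q i) {s : Finset ι} (hs : s.Nonempty)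
    (J K : Finset (Fin n)) :
    nodeQuotient Q s J 0 + 2 * ∑ k ∈ K, nodeQuotient Q s J ((k : ℕ) + 1) ≠ 0 := by
  -- `Q i₀` is the prime `p`; distances between nodes are smaller than `p`, so they are units.
  obtain ⟨i₀, hi₀, hmax⟩ := s.exists_max_image Q hs
  have : Fact (Q i₀).Prime := ⟨hp i₀⟩
  have unit : ∀ z : ℤ, z ≠ 0 → |z| < Q i₀ → padicNorm (Q i₀) z = 1 := fun z hz hlt => by
    rw [padicNorm.int_eq_one_iff]
    exact fun hd => hz (Int.eq_zero_of_abs_lt_dvd hd hlt)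
  have le1 : ∀ z : ℤ, padicNorm (Q i₀) z ≤ 1 := fun z => padicNorm.of_int z
  have small : ∀ k : Fin n, padicNorm (Q i₀) (nodeQuotient Q s J ((k : ℕ) + 1)) ≤ 1 := by
    intro k
    rw [nodeQuotient, padicNorm.div, padicNorm_prod, padicNorm_prod]
    have hden : ∏ i ∈ s, padicNorm (Q i₀) (((k : ℕ) : ℚ) + 1 - Q i) = 1 := by
      refine Finset.prod_eq_one fun i hi => ?_
      have := unit ((k : ℕ) + 1 - Q i) (by have := hn i; omega)
        (by have := hn i; have := hmax i hi; rw [abs_lt]; constructor <;> omega)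
      push_cast at this
      exact this
    rw [hden, div_one]
    refine Finset.prod_le_one (fun _ _ => padicNorm.nonneg _) fun j _ => ?_
    have := le1 ((k : ℕ) + 1 - ((j : ℕ) + 1))
    push_cast at this
    exact this
  have hbig : 1 < padicNorm (Q i₀) (nodeQuotient Q s J 0) := by
    rw [nodeQuotient, padicNorm.div, padicNorm_prod, padicNorm_prod]
    have hnum : ∏ j ∈ J, padicNorm (Q i₀) (0 - (((j : ℕ) : ℚ) + 1)) = 1 := by
      refine Finset.prod_eq_one fun j hj => ?_
      have := unit (0 - ((j : ℕ) + 1)) (by omega)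
        (by have := hn i₀; rw [abs_lt]; constructor <;> omega)
      push_cast at this
      exact this
    have hden : ∏ i ∈ s, padicNorm (Q i₀) (0 - (Q i : ℚ)) = (Q i₀ : ℚ)⁻¹ := by
      rw [Finset.prod_eq_single_of_mem i₀ hi₀, zero_sub, padicNorm.neg,
        padicNorm.padicNorm_p_of_prime]
      intro i hi hne
      have hlt : Q i < Q i₀ := lt_of_le_of_ne (hmax i hi) fun h => hne (hQ h)
      have := unit (0 - Q i) (by have := hn i; omega) (by rw [abs_lt]; constructor <;> omega)
      push_cast at this
      exact this
    rw [hnum, hden, one_div, inv_inv]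
    exact_mod_cast (hp i₀).one_lt
  have hsum : padicNorm (Q i₀) (2 * ∑ k ∈ K, nodeQuotient Q s J ((k : ℕ) + 1)) ≤ 1 := by
    rw [padicNorm.mul]
    refine mul_le_one₀ (by have := le1 2; push_cast at this; exact this) (padicNorm.nonneg _) ?_
    exact padicNorm.sum_le' (fun k _ => small k) zero_le_one
  intro h
  rw [eq_neg_of_add_eq_zero_left h, padicNorm.neg] at hbig
  exact absurd hsum (not_le.2 hbig)

section

variable {n : ℕ} {ι : Type} {L : Type*} [Field L] [CharZero L] {Q : Option ι → ℕ}

theorem node_ne {o : Option ι} (hn : ∀ o, n < Q o) (j : Fin n) :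
    (Q o : L) ≠ ((j : ℕ) : L) + 1 := by
  have := hn o
  have := j.2
  exact_mod_cast (by omega : Q o ≠ (j : ℕ) + 1)

theorem injective_succ_cast : Function.Injective fun j : Fin n => ((j : ℕ) : L) + 1 := by
  intro i j h
  simpa [Fin.ext_iff] using h

variable [Fintype ι]

/-- A nonzero vector is orthogonal to at most `|ι|` of the columns of a Cauchy matrix with
`|ι| + 1` rows. -/
theorem card_le_of_orthogonal (hQ : Function.Injective Q) (hn : ∀ o, n < Q o)
    {μ : Option ι → L} (hμ : μ ≠ 0) {J : Finset (Fin n)}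
    (hJ : ∀ j ∈ J, ∑ o, μ o / ((Q o : L) - ((j : ℕ) + 1)) = 0) :
    J.card ≤ Fintype.card ι := by
  classical
  by_contra! hlt
  refine hμ (funext fun o => ?_)
  refine eq_zero_of_sum_div_sub_eq_zero (I := J) (J := Finset.univ)
    (u := fun j : Fin n => ((j : ℕ) : L) + 1) (v := fun o => (Q o : L))
    injective_succ_cast.injOn
    (Nat.cast_injective.comp hQ).injOn (fun j _ o _ => (node_ne hn j).symm)
    (by rw [Finset.card_univ, Fintype.card_option]; omega) (fun j hj => ?_) o (Finset.mem_univ _)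
  rw [← neg_eq_zero, ← Finset.sum_neg_distrib, ← hJ j hj]
  exact Finset.sum_congr rfl fun o _ => by rw [← div_neg, neg_sub]

/-- The system has no critical points at infinity for `t = 0`. Here `b_j` stands for the leading
form of `T_d(x_j)`, and `μ` for the multipliers. -/
theorem eq_zero_of_cauchy (hQ : Function.Injective Q) (hn : ∀ o, n < Q o)
    {μ : Option ι → L} (hμ : μ ≠ 0) {b : Fin n → L}
    (hb : ∀ i, ∑ j, b j / ((Q (some i) : L) - ((j : ℕ) + 1)) = 0)
    (h : ∀ j, b j = 0 ∨ ∑ o, μ o / ((Q o : L) - ((j : ℕ) + 1)) = 0) : b = 0 := by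
  classical
  set J := Finset.univ.filter fun j : Fin n => ∑ o, μ o / ((Q o : L) - ((j : ℕ) + 1)) = 0 with hJ
  have hcard := card_le_of_orthogonal hQ hn hμ (J := J) (by simp [hJ])
  have hoff : ∀ j ∉ J, b j = 0 := fun j hj => (h j).resolve_right (by simpa [hJ] using hj)
  have hon := eq_zero_of_sum_div_sub_eq_zero (I := Finset.univ) (J := J)
    (u := fun i : ι => (Q (some i) : L)) (v := fun j : Fin n => ((j : ℕ) : L) + 1) (c := b)
    (Nat.cast_injective.comp (hQ.comp (Option.some_injective _))).injOn
    injective_succ_cast.injOn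
    (fun i _ j _ => node_ne hn j) (by rwa [Finset.card_univ]) fun i _ => by
      rw [← hb i]
      exact Finset.sum_subset (Finset.subset_univ _) fun j _ hj => by simp [hoff j hj]
  funext j
  by_cases hj : j ∈ J
  exacts [hon j hj, hoff j hj]

/-- At a critical point of the system for `t = 0` the multiplier of the objective is nonzero. Here
`y_j` stands for `T_d(x_j) + 1`, which is `0` or `2` where the derivative of `T_d` vanishes. Let `J`
be the set of columns orthogonal to `μ`. If `J` had fewer than `|ι|` elements, the constraints would
be overdetermined, in contradiction to `nodeQuotient_ne`; with `|ι|` elements, `μ none = 0` would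
force `μ = 0`. -/
theorem apply_none_ne_zero_of_cauchy (hQ : Function.Injective Q) (hn : ∀ o, n < Q o)
    (hp : ∀ i, (Q (some i)).Prime) {μ : Option ι → L} (hμ : μ ≠ 0) {y : Fin n → L}
    (hy : ∀ i, 1 / (Q (some i) : L) + ∑ j, y j / ((Q (some i) : L) - ((j : ℕ) + 1)) = 0)
    (h : ∀ j, (y j = 0 ∨ y j = 2) ∨ ∑ o, μ o / ((Q o : L) - ((j : ℕ) + 1)) = 0) :
    μ none ≠ 0 := by
  classical
  set J := Finset.univ.filter fun j : Fin n => ∑ o, μ o / ((Q o : L) - ((j : ℕ) + 1)) = 0 with hJ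
  have hJ0 : ∀ j ∈ J, ∑ o, μ o / ((Q o : L) - ((j : ℕ) + 1)) = 0 := by simp [hJ]
  have hinj : Function.Injective fun i : ι => (Q (some i) : L) :=
    Nat.cast_injective.comp (hQ.comp (Option.some_injective _))
  have hge : Fintype.card ι ≤ J.card := by
    by_contra! hlt
    obtain ⟨s, -, hs⟩ := Finset.exists_subset_card_eq (s := (Finset.univ : Finset ι))
      (n := J.card + 1) (by rw [Finset.card_univ]; omega)
    set K := Finset.univ.filter fun j : Fin n => j ∉ J ∧ y j = 2 with hK
    refine nodeQuotient_ne (Q := fun i => Q (some i)) (hQ.comp (Option.some_injective _)) hp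
      (fun i => hn _) (s := s) (Finset.card_pos.1 (by omega)) J K ?_
    -- `A` vanishes on the nodes of `J`; the weights `w` come from its partial fractions.
    set A : Polynomial L := Lagrange.nodal J fun j : Fin n => ((j : ℕ) : L) + 1 with hA
    have hAdeg : A.degree < s.card := by
      rw [hA, Lagrange.degree_nodal, hs]
      exact_mod_cast Nat.lt_succ_self _
    have key := fun z hz => sum_nodalWeight_mul_eval_div hinj.injOn hAdeg (z := z) hz
    set w : ι → L := fun i =>
      Lagrange.nodalWeight s (fun i : ι => (Q (some i) : L)) i * A.eval (Q (some i) : L) with hw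
    set R : L → L := fun z => A.eval z / ∏ i ∈ s, (z - Q (some i)) with hR
    have hcast : ∀ z : ℚ, ((nodeQuotient (fun i => Q (some i)) s J z : ℚ) : L) = R z := by
      intro z
      simp [nodeQuotient, hR, hA, Lagrange.eval_nodal]
    have hRj : ∀ j ∈ J, R (((j : ℕ) : L) + 1) = 0 := fun j hj => by
      rw [hR]
      exact div_eq_zero_iff.2
        (.inl (Lagrange.eval_nodal_at_node (v := fun j : Fin n => ((j : ℕ) : L) + 1) hj))
    have h1 : ∀ j : Fin n, ∑ i ∈ s, w i / ((Q (some i) : L) - ((j : ℕ) + 1)) =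
        -R (((j : ℕ) : L) + 1) := by
      intro j
      have := key (((j : ℕ) : L) + 1) fun i _ => (node_ne hn j).symm
      rw [hR]
      simp only
      rw [← this, ← Finset.sum_neg_distrib]
      exact Finset.sum_congr rfl fun i _ => by rw [← div_neg, neg_sub]
    have h0 : ∑ i ∈ s, w i / (Q (some i) : L) = -R 0 := by
      have := key 0 fun i _ => by
        have := hn (some i)
        exact_mod_cast (by omega : 0 ≠ Q (some i))
      rw [hR]
      simp only
      rw [← this, ← Finset.sum_neg_distrib]
      exact Finset.sum_congr rfl fun i _ => by rw [← div_neg, neg_sub, sub_zero]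
    have hsum : ∑ i ∈ s, w i * (1 / (Q (some i) : L) +
        ∑ j, y j / ((Q (some i) : L) - ((j : ℕ) + 1))) = 0 :=
      Finset.sum_eq_zero fun i _ => by rw [hy i, mul_zero]
    have hsum' : R 0 + ∑ j : Fin n, y j * R (((j : ℕ) : L) + 1) = 0 := by
      rw [← neg_eq_zero, neg_add, ← h0, ← Finset.sum_neg_distrib, ← hsum]
      simp_rw [mul_add, Finset.sum_add_distrib, Finset.mul_sum]
      congr 1
      · exact Finset.sum_congr rfl fun i _ => by ring
      · rw [Finset.sum_comm]
        refine Finset.sum_congr rfl fun j _ => ?_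
        rw [← mul_neg, ← h1, Finset.mul_sum]
        exact Finset.sum_congr rfl fun i _ => by ring
    have hK' : ∑ j : Fin n, y j * R (((j : ℕ) : L) + 1) =
        2 * ∑ k ∈ K, R (((k : ℕ) : L) + 1) := by
      rw [Finset.mul_sum]
      symm
      refine (Finset.sum_congr rfl fun k hk => ?_).trans
        (Finset.sum_subset (Finset.subset_univ K) fun j _ hj => ?_)
      · rw [(Finset.mem_filter.1 hk).2.2]
      · by_cases hjJ : j ∈ J
        · rw [hRj j hjJ, mul_zero]
        · have h2 : y j ≠ 2 := fun h2 => hj (by simp [hK, hjJ, h2])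
          have := ((h j).resolve_right (by simpa [hJ] using hjJ)).resolve_right h2
          rw [this, zero_mul]
    have : ((nodeQuotient (fun i => Q (some i)) s J 0 +
        2 * ∑ k ∈ K, nodeQuotient (fun i => Q (some i)) s J ((k : ℕ) + 1) : ℚ) : L) = 0 := by
      push_cast
      simp_rw [hcast]
      push_cast
      rw [← hK', hsum']
    exact_mod_cast this
  intro h0
  refine hμ (funext fun o => ?_)
  cases o with
  | none => exact h0
  | some i =>
    refine eq_zero_of_sum_div_sub_eq_zero (I := J) (J := Finset.univ)
      (u := fun j : Fin n => ((j : ℕ) : L) + 1) (v := fun i : ι => (Q (some i) : L))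
      (c := fun i => μ (some i)) injective_succ_cast.injOn
      hinj.injOn (fun j _ i _ => (node_ne hn j).symm)
      (by rwa [Finset.card_univ]) (fun j hj => ?_) i (Finset.mem_univ _)
    have := hJ0 j hj
    rw [Fintype.sum_option, h0, zero_div, zero_add] at this
    rw [← neg_eq_zero, ← Finset.sum_neg_distrib, ← this]
    exact Finset.sum_congr rfl fun o _ => by rw [← div_neg, neg_sub]

end

/-! ### Critical points over a valuation ring -/

section Reduction

variable {n : ℕ} {ι : Type} [Fintype ι]

open Polynomial in
/-- The homogenization of degree `e` of a univariate polynomial `p`, evaluated at `(w, y)`: this is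
`w ^ e * p (y / w)` if `w` is invertible. -/
noncomputable def homEval {A : Type*} [CommRing A] [Algebra ℂ A] (p : ℂ[X]) (e : ℕ) (w y : A) : A :=
  ∑ k ∈ Finset.range (e + 1), algebraMap ℂ A (p.coeff k) * y ^ k * w ^ (e - k)

theorem map_homEval {A B : Type*} [CommRing A] [Algebra ℂ A] [CommRing B] [Algebra ℂ B]
    (φ : A →ₐ[ℂ] B) (p : Polynomial ℂ) (e : ℕ) (w y : A) :
    φ (homEval p e w y) = homEval p e (φ w) (φ y) := by
  simp [homEval]

theorem homEval_mul {A : Type*} [CommRing A] [Algebra ℂ A] {p : Polynomial ℂ} {e : ℕ}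
    (hp : p.natDegree ≤ e) (w x : A) :
    homEval p e w (w * x) = w ^ e * Polynomial.aeval x p := by
  rw [homEval, Polynomial.aeval_eq_sum_range' (Nat.lt_succ_of_le hp), Finset.mul_sum]
  refine Finset.sum_congr rfl fun k hk => ?_
  have : w ^ e = w ^ k * w ^ (e - k) := by
    rw [← pow_add, Nat.add_sub_cancel' (Nat.lt_succ_iff.1 (Finset.mem_range.1 hk))]
  rw [this, Algebra.smul_def]
  ring

theorem homEval_zero {A : Type*} [CommRing A] [Algebra ℂ A] (p : Polynomial ℂ) (e : ℕ) (y : A) :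
    homEval p e 0 y = algebraMap ℂ A (p.coeff e) * y ^ e := by
  rw [homEval, Finset.sum_range_succ, Finset.sum_eq_zero, zero_add]
  · simp
  · intro k hk
    rw [zero_pow (by have := Finset.mem_range.1 hk; omega), mul_zero]

/-- The homogenization of a polynomial in several variables, evaluated at `(w, X)`: if the elements
`w` and `w * x_j` are integral, then so is `w ^ e * p(x)`. -/
theorem exists_eq_pow_mul_aeval {A K : Type*} [CommRing A] [Algebra ℂ A] [CommRing K]
    [Algebra ℂ K] (ψ : A →ₐ[ℂ] K) {p : MvPolynomial (Fin n) ℂ} {e : ℕ} (hp : p.totalDegree ≤ e)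
    {w : A} {X : Fin n → A} {x : Fin n → K} (hx : ∀ j, ψ (X j) = ψ w * x j) :
    ∃ h : A, ψ h = ψ w ^ e * MvPolynomial.aeval x p := by
  refine ⟨∑ s ∈ p.support, algebraMap ℂ A (p.coeff s) *
    (w ^ (e - s.sum fun _ k => k) * ∏ j, X j ^ s j), ?_⟩
  rw [MvPolynomial.aeval_def, MvPolynomial.eval₂_eq', Finset.mul_sum, map_sum]
  refine Finset.sum_congr rfl fun s hs => ?_
  have hle : (s.sum fun _ k => k) ≤ e := (MvPolynomial.le_totalDegree hs).trans hp
  have hsum : (s.sum fun _ k => k) = ∑ j, s j := Finsupp.sum_fintype _ _ fun _ => rfl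
  have : ψ w ^ e = ψ w ^ (e - s.sum fun _ k => k) * ∏ j, ψ w ^ s j := by
    rw [Finset.prod_pow_eq_pow_sum, ← hsum, ← pow_add, Nat.sub_add_cancel hle]
  rw [this]
  simp only [map_mul, map_pow, map_prod, AlgHom.commutes, hx, mul_pow, Finset.prod_mul_distrib]
  ring

/-- The Lagrange multipliers with the signs of the deformation absorbed. -/
def signedMultiplier {κ : Type} {L : Type*} [CommRing L] (ε : κ → ℤˣ) (lam : Option κ → L) :
    Option κ → L :=
  fun o => o.elim (lam none) fun i => -(((ε i : ℤ) : L) * lam (some i))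

variable {d : ℕ} {a₀ : ι → ℂ} {a : Option ι → Fin n → ℂ} {T : Polynomial ℂ}
  {ε : ι → ℤˣ} {P : ι → MvPolynomial (Fin n) ℂ} {g : MvPolynomial (Fin n) ℂ}

/-- `(t, x, λ)` solves the critical point equations, over a `ℂ`-algebra. Here `a₀` and `a` are the
coefficients of the polynomials at `t = 0`, and `T` is the univariate polynomial used there. -/
structure IsCritical {K : Type*} [CommRing K] [Algebra ℂ K] (a₀ : ι → ℂ) (a : Option ι → Fin n → ℂ)
    (T : Polynomial ℂ) (ε : ι → ℤˣ) (P : ι → MvPolynomial (Fin n) ℂ) (g : MvPolynomial (Fin n) ℂ)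
    (t : K) (x : Fin n → K) (lam : Option ι → K) : Prop where
  constraint : ∀ i, t * MvPolynomial.aeval x (P i) + ((ε i : ℤ) : K) * (1 - t) *
    (algebraMap ℂ K (a₀ i) +
      ∑ j, algebraMap ℂ K (a (some i) j) * (Polynomial.aeval (x j) T + 1)) = 0
  stationary : ∀ j, lam none * (t * MvPolynomial.aeval x (MvPolynomial.pderiv j g) +
      (1 - t) * (algebraMap ℂ K (a none j) * Polynomial.aeval (x j) T.derivative)) =
    ∑ i, lam (some i) * (t * MvPolynomial.aeval x (MvPolynomial.pderiv j (P i)) +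
      ((ε i : ℤ) : K) * (1 - t) *
        (algebraMap ℂ K (a (some i) j) * Polynomial.aeval (x j) T.derivative))

theorem IsCritical.smul {K : Type*} [CommRing K] [Algebra ℂ K] {t : K} {x : Fin n → K}
    {lam : Option ι → K} (h : IsCritical a₀ a T ε P g t x lam) (c : K) :
    IsCritical a₀ a T ε P g t x (c • lam) where
  constraint := h.constraint
  stationary j := by
    simp only [Pi.smul_apply, smul_eq_mul, mul_assoc c, ← Finset.mul_sum]
    rw [h.stationary j]

theorem totalDegree_pderiv_le {σ R : Type*} [CommSemiring R] {p : MvPolynomial σ R} {e : ℕ}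
    (hp : p.totalDegree ≤ e) (j : σ) : (MvPolynomial.pderiv j p).totalDegree ≤ e - 1 := by
  classical
  rw [p.as_sum, map_sum]
  refine (MvPolynomial.totalDegree_finsetSum _ _).trans (Finset.sup_le fun s hs => ?_)
  rw [MvPolynomial.pderiv_monomial]
  by_cases hj : s j = 0
  · simp [hj]
  refine (MvPolynomial.totalDegree_monomial_le _ _).trans ?_
  have h1 := (MvPolynomial.le_totalDegree hs).trans hp
  have h2 : (s - Finsupp.single j 1) + Finsupp.single j 1 = s :=
    tsub_add_cancel_of_le (by simpa using Nat.one_le_iff_ne_zero.2 hj)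
  have h3 : (s.sum fun _ k => k) = ((s - Finsupp.single j 1).sum fun _ k => k) + 1 := by
    conv_lhs => rw [← h2]
    rw [Finsupp.sum_add_index' (fun _ => rfl) fun _ _ _ => rfl, Finsupp.sum_single_index rfl]
  change ((s - Finsupp.single j 1).sum fun _ k => k) ≤ e - 1
  omega

/-- Specializing a solution at a place `ρ` over `t = 0`. The element `w` is a denominator of `x`, so
that `(w, X)` are homogeneous coordinates of `x`; the resulting equations are those of the system at
`t = 0`, homogenized in `x`. -/
theorem IsCritical.specialize {A K L : Type*} [CommRing A] [Algebra ℂ A] [Field K] [Algebra ℂ K]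
    [Field L] [Algebra ℂ L] {ψ : A →ₐ[ℂ] K} (hψ : Function.Injective ψ) (ρ : A →ₐ[ℂ] L)
    (hT : T.natDegree ≤ d) (hP : ∀ i, (P i).totalDegree ≤ d) (hg : g.totalDegree ≤ d)
    {t w : A} {X : Fin n → A} {lam : Option ι → A} {x : Fin n → K}
    (hx : ∀ j, ψ (X j) = ψ w * x j) (ht : ρ t = 0)
    (h : IsCritical a₀ a T ε P g (ψ t) x fun o => ψ (lam o)) :
    (∀ i, algebraMap ℂ L (a₀ i) * ρ w ^ d + ∑ j, algebraMap ℂ L (a (some i) j) *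
        (homEval T d (ρ w) (ρ (X j)) + ρ w ^ d) = 0) ∧
      ∀ j, (∑ o, signedMultiplier ε (fun o => ρ (lam o)) o * algebraMap ℂ L (a o j)) *
        homEval T.derivative (d - 1) (ρ w) (ρ (X j)) = 0 := by
  constructor
  · intro i
    obtain ⟨p, hp⟩ := exists_eq_pow_mul_aeval ψ (hP i) hx
    have key : t * p + ((ε i : ℤ) : A) * (1 - t) * (algebraMap ℂ A (a₀ i) * w ^ d +
        ∑ j, algebraMap ℂ A (a (some i) j) * (homEval T d w (X j) + w ^ d)) = 0 := by
      apply hψ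
      simp only [map_add, map_mul, map_sub, map_one, map_sum, map_pow, map_intCast,
        AlgHom.commutes, map_homEval, map_zero, hp, hx, homEval_mul hT]
      rw [← mul_zero (ψ w ^ d), ← h.constraint i]
      simp only [mul_add, Finset.mul_sum, Finset.sum_add_distrib]
      simp only [mul_left_comm (ψ w ^ d), mul_one, mul_comm _ (ψ w ^ d)]
    have := congrArg ρ key
    simp only [map_add, map_mul, map_sub, map_one, map_sum, map_pow, map_intCast,
      AlgHom.commutes, map_homEval, map_zero, ht, zero_mul, zero_add, sub_zero, mul_one] at this
    refine (mul_eq_zero.1 this).resolve_left ?_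
    rcases Int.units_eq_one_or (ε i) with h | h <;> simp [h]
  · intro j
    obtain ⟨p, hp⟩ := exists_eq_pow_mul_aeval ψ (totalDegree_pderiv_le hg j) hx
    choose p' hp' using fun i => exists_eq_pow_mul_aeval ψ (totalDegree_pderiv_le (hP i) j) hx
    have hT' : T.derivative.natDegree ≤ d - 1 :=
      (Polynomial.natDegree_derivative_le T).trans (Nat.sub_le_sub_right hT 1)
    have key : lam none * (t * p + (1 - t) * (algebraMap ℂ A (a none j) *
          homEval T.derivative (d - 1) w (X j))) =
        ∑ i, lam (some i) * (t * p' i + ((ε i : ℤ) : A) * (1 - t) *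
          (algebraMap ℂ A (a (some i) j) * homEval T.derivative (d - 1) w (X j))) := by
      apply hψ
      have h2 := congrArg (ψ w ^ (d - 1) * ·) (h.stationary j)
      simp only [Finset.mul_sum] at h2
      simp only [map_add, map_mul, map_sub, map_one, map_sum, map_intCast,
        AlgHom.commutes, map_homEval, hp, hp', hx, homEval_mul hT']
      convert h2 using 1
      · ring
      · exact Finset.sum_congr rfl fun i _ => by ring
    have := congrArg ρ key
    simp only [map_add, map_mul, map_sub, map_one, map_sum, map_intCast,
      AlgHom.commutes, map_homEval, ht, zero_mul, zero_add, sub_zero, mul_one, one_mul] at this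
    rw [Fintype.sum_option]
    simp only [signedMultiplier, Option.elim]
    rw [add_mul, mul_assoc, this, Finset.sum_mul, ← Finset.sum_add_distrib]
    exact Finset.sum_eq_zero fun i _ => by ring

end Reduction

/-- The homogeneous coordinates of a point can be made integral, with one of them equal to `1`. -/
theorem exists_forall_div_mem {K α : Type*} [Field K] [Finite α] (O : ValuationSubring K)
    {v : α → K} (hv : v ≠ 0) : ∃ k, v k ≠ 0 ∧ ∀ i, v i / v k ∈ O := by
  obtain ⟨i₀, hi₀⟩ := Function.ne_iff.1 hv
  have : Nonempty α := ⟨i₀⟩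
  obtain ⟨k, hk⟩ := Finite.exists_max fun i => O.valuation (v i)
  have hk0 : v k ≠ 0 := by
    intro h
    have := hk i₀
    rw [h, map_zero, le_zero_iff, map_eq_zero] at this
    exact hi₀ this
  refine ⟨k, hk0, fun i => ?_⟩
  rw [← O.valuation_le_one_iff, map_div₀]
  exact div_le_one_of_le₀ (hk i) zero_le

section Valuation

variable {n d : ℕ} {ι : Type} [Fintype ι] {Q : Option ι → ℕ}
  {ε : ι → ℤˣ} {P : ι → MvPolynomial (Fin n) ℂ} {g : MvPolynomial (Fin n) ℂ}

/-- The entries `1 / (Q_o - (j + 1))` of a Cauchy matrix. -/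
noncomputable def cauchyEntry (Q : Option ι → ℕ) (o : Option ι) (j : Fin n) : ℂ :=
  1 / ((Q o : ℂ) - ((j : ℕ) + 1))

open Polynomial in
/-- The Pell equation for Chebyshev polynomials. -/
theorem chebyshev_pell (R : Type*) [CommRing R] (d : ℕ) :
    Chebyshev.T R (d : ℤ) ^ 2 - (X ^ 2 - 1) * Chebyshev.U R ((d : ℤ) - 1) ^ 2 = 1 := by
  induction d with
  | zero => simp
  | succ d ih =>
    have h1 := Chebyshev.T_eq_X_mul_T_sub_pol_U R ((d : ℤ) - 1)
    have h2 := Chebyshev.U_eq_X_mul_U_add_T R ((d : ℤ) - 1)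
    rw [sub_add_cancel, show (d : ℤ) - 1 + 2 = d + 1 by ring] at h1
    rw [sub_add_cancel] at h2
    rw [Nat.cast_succ, add_sub_cancel_right, h1, h2]
    linear_combination ih

open Polynomial in
/-- The critical values of `T_d` are `±1`. -/
theorem chebyshev_eval_add_one {L : Type*} [Field L] [Algebra ℂ L] (hd : 0 < d) {x : L}
    (hx : aeval x (Chebyshev.T ℂ (d : ℤ)).derivative = 0) :
    aeval x (Chebyshev.T ℂ (d : ℤ)) + 1 = 0 ∨ aeval x (Chebyshev.T ℂ (d : ℤ)) + 1 = 2 := by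
  have hd' : (d : L) ≠ 0 := by
    have := charZero_of_injective_algebraMap (algebraMap ℂ L).injective
    exact_mod_cast hd.ne'
  have h1 := congrArg (aeval x) (Chebyshev.T_derivative_eq_U (R := ℂ) (d : ℤ))
  rw [hx, map_mul] at h1
  simp only [Int.cast_natCast, map_natCast, zero_eq_mul, hd', false_or] at h1
  have h2 := congrArg (aeval x) (chebyshev_pell ℂ d)
  simp only [map_sub, map_pow, map_mul, h1, map_one] at h2
  have h3 : (aeval x (Chebyshev.T ℂ (d : ℤ)) + 1) *
      (aeval x (Chebyshev.T ℂ (d : ℤ)) + 1 - 2) = 0 := by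
    linear_combination h2
  exact (mul_eq_zero.1 h3).imp_right sub_eq_zero.1

theorem natDegree_chebyshev (d : ℕ) : (Polynomial.Chebyshev.T ℂ (d : ℤ)).natDegree = d := by
  rw [Polynomial.Chebyshev.natDegree_T, Int.natAbs_natCast]

section Field

variable {L : Type*} [Field L] [Algebra ℂ L] {μ : Option ι → L} {X : Fin n → L} {w : L}

theorem eq_zero_of_critical_at_infinity (hd : 0 < d) (hQ : Function.Injective Q)
    (hn : ∀ o, n < Q o) (hμ : μ ≠ 0)
    (e1 : ∀ i, algebraMap ℂ L (1 / (Q (some i) : ℂ)) * 0 ^ d +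
      ∑ j, algebraMap ℂ L (cauchyEntry Q (some i) j) *
        (homEval (Polynomial.Chebyshev.T ℂ (d : ℤ)) d 0 (X j) + 0 ^ d) = 0)
    (e2 : ∀ j, (∑ o, μ o * algebraMap ℂ L (cauchyEntry Q o j)) *
      homEval (Polynomial.Chebyshev.T ℂ (d : ℤ)).derivative (d - 1) 0 (X j) = 0) : X = 0 := by
  have := charZero_of_injective_algebraMap (algebraMap ℂ L).injective
  set c := (Polynomial.Chebyshev.T ℂ (d : ℤ)).coeff d with hc'
  have hc : c ≠ 0 := by
    have h : (Polynomial.Chebyshev.T ℂ (d : ℤ)).leadingCoeff ≠ 0 := by simp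
    rwa [Polynomial.leadingCoeff, natDegree_chebyshev] at h
  simp only [cauchyEntry, homEval_zero, zero_pow hd.ne', mul_zero, add_zero, zero_add,
    map_div₀, map_one, map_sub, map_add, map_natCast, one_div_mul_eq_div, mul_one_div] at e1 e2
  have hb := eq_zero_of_cauchy hQ hn hμ (b := fun j => algebraMap ℂ L c * X j ^ d) e1 fun j => by
    rcases mul_eq_zero.1 (e2 j) with h | h
    · exact .inr h
    · left
      rw [Polynomial.coeff_derivative, Nat.sub_add_cancel hd, map_mul] at h
      have h4 : algebraMap ℂ L (((d - 1 : ℕ) : ℂ) + 1) ≠ 0 := by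
        rw [map_ne_zero]
        exact Nat.cast_add_one_ne_zero (d - 1)
      rcases mul_eq_zero.1 h with h | h
      · rw [(mul_eq_zero.1 h).resolve_right h4, zero_mul]
      · rw [show X j = 0 from eq_zero_of_pow_eq_zero h, zero_pow hd.ne', mul_zero]
  funext j
  have h5 := congrFun hb j
  simp only [Pi.zero_apply, mul_eq_zero, map_eq_zero, hc, false_or] at h5
  exact eq_zero_of_pow_eq_zero h5

theorem multiplier_ne_zero_of_critical (hd : 0 < d) (hQ : Function.Injective Q)
    (hn : ∀ o, n < Q o) (hp : ∀ i, (Q (some i)).Prime) (hμ : μ ≠ 0)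
    (e1 : ∀ i, algebraMap ℂ L (1 / (Q (some i) : ℂ)) * 1 ^ d +
      ∑ j, algebraMap ℂ L (cauchyEntry Q (some i) j) *
        (homEval (Polynomial.Chebyshev.T ℂ (d : ℤ)) d 1 (X j) + 1 ^ d) = 0)
    (e2 : ∀ j, (∑ o, μ o * algebraMap ℂ L (cauchyEntry Q o j)) *
      homEval (Polynomial.Chebyshev.T ℂ (d : ℤ)).derivative (d - 1) 1 (X j) = 0) :
    μ none ≠ 0 := by
  have := charZero_of_injective_algebraMap (algebraMap ℂ L).injective
  have hev : ∀ (p : Polynomial ℂ) (e : ℕ) (y : L), p.natDegree ≤ e →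
      homEval p e 1 y = Polynomial.aeval y p := fun p e y hpe => by
    have := homEval_mul hpe 1 y
    rwa [one_mul, one_pow, one_mul] at this
  simp only [cauchyEntry, one_pow, mul_one, map_div₀, map_one, map_sub, map_add, map_natCast,
    one_div_mul_eq_div, mul_one_div] at e1 e2
  refine apply_none_ne_zero_of_cauchy hQ hn hp hμ e1 fun j => ?_
  rcases mul_eq_zero.1 (e2 j) with h | h
  · exact .inr h
  · left
    rw [hev _ _ _ (natDegree_chebyshev d).le]
    rw [hev _ _ _ ((Polynomial.natDegree_derivative_le _).trans
      (Nat.sub_le_sub_right (natDegree_chebyshev d).le 1))] at h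
    exact chebyshev_eval_add_one hd h

end Field

theorem signedMultiplier_ne_zero {κ : Type} {ε : κ → ℤˣ} {L : Type*} [CommRing L]
    {lam : Option κ → L} (h : lam ≠ 0) :
    signedMultiplier ε lam ≠ 0 := by
  contrapose! h
  funext o
  have := congrFun h o
  cases o with
  | none => exact this
  | some i =>
    rcases Int.units_eq_one_or (ε i) with hε | hε <;> simpa [signedMultiplier, hε] using this

/-- A solution over a field extension of `ℂ` stays finite, with nonzero first multiplier, at every
place where `t` vanishes. -/
theorem IsCritical.mem_valuationSubring (hd : 0 < d) (hQ : Function.Injective Q)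
    (hn : ∀ o, n < Q o) (hp : ∀ i, (Q (some i)).Prime)
    (hP : ∀ i, (P i).totalDegree ≤ d) (hg : g.totalDegree ≤ d)
    {K : Type*} [Field K] [Algebra ℂ K] (O : ValuationSubring K)
    (hO : ∀ c : ℂ, algebraMap ℂ K c ∈ O) {t : K} (ht : t ∈ O.nonunits) {x : Fin n → K}
    {lam : Option ι → K} (hlam : lam ≠ 0)
    (h : IsCritical (fun i => 1 / (Q (some i) : ℂ)) (cauchyEntry Q)
      (Polynomial.Chebyshev.T ℂ (d : ℤ)) ε P g t x lam) :
    (∀ j, x j ∈ O) ∧ lam none ≠ 0 ∧ ∀ o, lam o / lam none ∈ O := by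
  classical
  let alg : Algebra ℂ O := ((algebraMap ℂ K).codRestrict O.toSubring hO).toAlgebra
  let ψ : O →ₐ[ℂ] K := { O.subtype with commutes' := fun _ => rfl }
  have hψ : Function.Injective ψ := Subtype.val_injective
  obtain ⟨L, _, _, ρ, hρ⟩ : ∃ (L : Type _) (_ : Field L) (_ : Algebra ℂ L) (ρ : O →ₐ[ℂ] L),
      ∀ y : O, ρ y = 0 ↔ (y : K) ∈ O.nonunits := by
    refine ⟨IsLocalRing.ResidueField O, inferInstance, inferInstance,
      IsScalarTower.toAlgHom ℂ O (IsLocalRing.ResidueField O), fun y => ?_⟩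
    rw [ValuationSubring.coe_mem_nonunits_iff]
    exact IsLocalRing.residue_eq_zero_iff y
  have hinv : ∀ y : K, y ∉ O.nonunits → y⁻¹ ∈ O := fun y hy => by
    by_contra h
    exact hy (by simpa using O.inv_mem_nonunits_iff.2 (.inr h))
  obtain ⟨k, hk0, hk⟩ := exists_forall_div_mem O hlam
  set Λ : Option ι → O := fun o => ⟨lam o / lam k, hk o⟩ with hΛ
  have hμ0 : signedMultiplier ε (fun o => ρ (Λ o)) ≠ 0 := by
    refine signedMultiplier_ne_zero (Function.ne_iff.2 ⟨k, ?_⟩)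
    have : Λ k = 1 := Subtype.ext (div_self hk0)
    rw [this, map_one]
    exact one_ne_zero
  obtain ⟨T, hT⟩ : ∃ T : O, ψ T = t := ⟨⟨t, O.nonunits_subset ht⟩, rfl⟩
  have hT0 : ρ T = 0 := (hρ T).2 (by rw [show (T : K) = t from hT]; exact ht)
  have hΛ' : IsCritical (fun i => 1 / (Q (some i) : ℂ)) (cauchyEntry Q)
      (Polynomial.Chebyshev.T ℂ (d : ℤ)) ε P g (ψ T) x fun o => ψ (Λ o) := by
    have h3 : (fun o => ψ (Λ o)) = (lam k)⁻¹ • lam := funext fun o => div_eq_inv_mul _ _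
    rw [h3, hT]
    exact h.smul _
  have hxO : ∀ j, x j ∈ O := by
    -- Scale `x` so that it becomes integral; it may then not reduce to a point at infinity.
    obtain ⟨k', hk'0, hk'⟩ := exists_forall_div_mem O
      (v := fun o : Option (Fin n) => o.elim 1 x) (Function.ne_iff.2 ⟨none, one_ne_zero⟩)
    set u := (fun o : Option (Fin n) => o.elim 1 x) k' with hu
    set w : O := ⟨1 / u, hk' none⟩ with hw
    set X : Fin n → O := fun j => ⟨x j / u, hk' (some j)⟩ with hX
    obtain ⟨e1, e2⟩ := hΛ'.specialize hψ ρ (natDegree_chebyshev d).le hP hg (w := w) (X := X)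
      (fun j => div_eq_inv_mul (x j) u |>.trans (by rw [← one_div]; rfl)) hT0
    have hw0 : ρ w ≠ 0 := by
      intro hw0
      rw [hw0] at e1 e2
      have hX0 := eq_zero_of_critical_at_infinity (X := fun j => ρ (X j)) hd hQ hn hμ0 e1 e2
      cases k' with
      | none =>
        have : w = 1 := Subtype.ext (by simp [hw, hu])
        rw [this, map_one] at hw0
        exact one_ne_zero hw0
      | some j =>
        have h5 := congrFun hX0 j
        have : X j = 1 := Subtype.ext (div_self hk'0)
        simp only [this, map_one, Pi.zero_apply, one_ne_zero] at h5
    intro j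
    have h6 : u ∈ O := by
      have := hinv _ fun h => hw0 ((hρ w).2 h)
      rwa [show (w : K) = u⁻¹ from one_div u, inv_inv] at this
    have := O.mul_mem _ _ (hk' (some j)) h6
    rwa [div_mul_cancel₀ _ hk'0] at this
  refine ⟨hxO, ?_⟩
  obtain ⟨e1, e2⟩ := hΛ'.specialize hψ ρ (natDegree_chebyshev d).le hP hg (w := 1)
    (X := fun j => ⟨x j, hxO j⟩) (fun j => by rw [map_one, one_mul]; rfl) hT0
  rw [map_one] at e1 e2
  have hμ1 := multiplier_ne_zero_of_critical hd hQ hn hp hμ0 e1 e2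
  have h7 : lam none / lam k ∉ O.nonunits := fun h => hμ1 ((hρ (Λ none)).2 h)
  have h8 : lam none ≠ 0 := by
    intro h0
    refine h7 ?_
    rw [h0, zero_div]
    exact zero_mem _
  refine ⟨h8, fun o => ?_⟩
  have := O.mul_mem _ _ (hk o) (hinv _ h7)
  rwa [inv_div, div_mul_div_cancel₀ hk0] at this

end Valuation

/-! ### Places and algebraic dependence -/

section Places

variable {K : Type*} [Field K] [Algebra ℂ K]

/-- Algebraically independent elements vanish simultaneously at some place. -/
theorem exists_valuationSubring_of_algebraicIndependent {α : Type*} {v : α → K}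
    (hv : AlgebraicIndependent ℂ v) :
    ∃ O : ValuationSubring K, (∀ c : ℂ, algebraMap ℂ K c ∈ O) ∧ ∀ i, v i ∈ O.nonunits := by
  set A := Algebra.adjoin ℂ (Set.range v) with hA
  set φ : A.toSubring →+* ℂ :=
    (MvPolynomial.constantCoeff (σ := α)).comp hv.aevalEquiv.symm.toRingEquiv.toRingHom with hφ
  obtain ⟨O, h1, h2⟩ := Ideal.image_subset_nonunits_valuationSubring (A := A.toSubring)
    (RingHom.ker φ) (RingHom.ker_ne_top φ)
  refine ⟨O, fun c => h1 (A.algebraMap_mem c), fun i => h2 ?_⟩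
  refine ⟨⟨v i, Algebra.subset_adjoin ⟨i, rfl⟩⟩, ?_, rfl⟩
  change φ _ = 0
  have : hv.aevalEquiv.symm ⟨v i, Algebra.subset_adjoin ⟨i, rfl⟩⟩ = MvPolynomial.X i := by
    rw [AlgEquiv.symm_apply_eq]
    exact Subtype.ext (by simp)
  have h3 : φ ⟨v i, Algebra.subset_adjoin ⟨i, rfl⟩⟩ = MvPolynomial.constantCoeff
    (hv.aevalEquiv.symm ⟨v i, Algebra.subset_adjoin ⟨i, rfl⟩⟩) := rfl
  rw [h3, this, MvPolynomial.constantCoeff_X]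

/-- An element without a pole at the places where `t` vanishes is algebraic over `ℂ(t)`. -/
theorem isAlgebraic_of_forall_mem_valuationSubring {t u : K} (ht : Transcendental ℂ t)
    (hu : ∀ O : ValuationSubring K, (∀ c : ℂ, algebraMap ℂ K c ∈ O) → t ∈ O.nonunits → u ∈ O) :
    IsAlgebraic (Algebra.adjoin ℂ {t}) u := by
  by_contra hcon
  have h0 : u ≠ 0 := by
    rintro rfl
    exact hcon isAlgebraic_zero
  have h1 : AlgebraicIndependent ℂ fun o : Option Unit => o.elim u⁻¹ fun _ => t := by
    rw [AlgebraicIndependent.option_iff, Set.range_const]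
    exact ⟨algebraicIndependent_unique_type_iff.2 ht, fun h => hcon (IsAlgebraic.inv_iff.1 h)⟩
  obtain ⟨O, hO, h2⟩ := exists_valuationSubring_of_algebraicIndependent h1
  exact (O.inv_mem_nonunits_iff.1 (h2 none)).resolve_left h0 (hu O hO (h2 (some ())))

/-- In transcendence degree at most one, two elements `y` and `f ≠ 0` satisfy an algebraic relation
that is not divisible by the variable standing for `f`. -/
theorem exists_relation {t : K} [Algebra.IsAlgebraic (Algebra.adjoin ℂ {t}) K] (y : K) {f : K}
    (hf : f ≠ 0) : ∃ Q : Polynomial (Polynomial ℂ), Q.coeff 0 ≠ 0 ∧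
      Q.eval₂ (Polynomial.aeval y : Polynomial ℂ →ₐ[ℂ] K).toRingHom f = 0 := by
  by_cases hy : Transcendental ℂ y
  swap
  · rw [Transcendental, not_not] at hy
    obtain ⟨p, hp, hpy⟩ := hy
    exact ⟨Polynomial.C p, by simpa using hp, by simpa using hpy⟩
  have hfy : IsAlgebraic (Algebra.adjoin ℂ {y}) f := by
    by_contra hcon
    have h1 : AlgebraicIndependent ℂ fun o : Option Unit => o.elim f fun _ => y := by
      rw [AlgebraicIndependent.option_iff, Set.range_const]
      exact ⟨algebraicIndependent_unique_type_iff.2 hy, hcon⟩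
    have h2 := h1.lift_cardinalMk_le_trdeg
    have h3 : Algebra.trdeg ℂ K ≤ Cardinal.mk ({t} : Set K) :=
      Algebra.IsAlgebraic.trdeg_le_cardinalMk ℂ {t}
    rw [Cardinal.mk_singleton] at h3
    have h4 := h2.trans (Cardinal.lift_le.2 h3)
    rw [Cardinal.mk_fintype, Cardinal.lift_natCast, Cardinal.lift_one] at h4
    have h5 : Fintype.card (Option Unit) ≤ 1 := by exact_mod_cast h4
    simp at h5
  obtain ⟨q, hq0, hq⟩ := hfy.exists_nonzero_coeff_and_aeval_eq_zero
    (mem_nonZeroDivisors_of_ne_zero hf)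
  let π : Polynomial ℂ →+* Algebra.adjoin ℂ {y} :=
    ((Polynomial.aeval y : Polynomial ℂ →ₐ[ℂ] K).codRestrict (Algebra.adjoin ℂ {y}) fun p => by
      rw [Algebra.adjoin_singleton_eq_range_aeval]
      exact ⟨p, rfl⟩).toRingHom
  have hπ : Function.Surjective π := by
    rintro ⟨z, hz⟩
    have hz' := hz
    rw [Algebra.adjoin_singleton_eq_range_aeval] at hz'
    obtain ⟨p, hp⟩ := hz'
    exact ⟨p, Subtype.ext hp⟩
  obtain ⟨Q, rfl⟩ := Polynomial.map_surjective π hπ q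
  refine ⟨Q, fun h => hq0 (by rw [Polynomial.coeff_map, h, map_zero]), ?_⟩
  rw [Polynomial.aeval_def, Polynomial.eval₂_map] at hq
  exact hq

end Places

/-! ### The Zariski topology of the mixed space -/

namespace MixedSpace

variable {n : ℕ} {ι : Type}

theorem isClosed_iff {Z : Set (MixedSpace n ι)} : IsClosed Z ↔ IsZariskiClosed Z := by
  rw [← isOpen_compl_iff]
  change IsZariskiClosed Zᶜᶜ ↔ _
  rw [compl_compl]

/-- The weights of the variables: `0` for `t, x` and `1` for `λ`. -/
abbrev lamWeight (n : ℕ) (ι : Type) : Vars n ι → ℕ := Sum.elim (fun _ => 0) (fun _ => 1)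

theorem isClosed_zeros {F : MvPolynomial (Vars n ι) ℂ} (hF : IsLamHomogeneous F) :
    IsClosed {p : MixedSpace n ι | MvPolynomial.eval p.coords F = 0} :=
  isClosed_iff.2 ⟨{F}, by simpa using hF, by simp [zeroLocus]⟩

/-- The affine coordinates of a point in the chart `λ_k ≠ 0`. -/
noncomputable def chart (k : Option ι) (p : MixedSpace n ι) : Vars n ι → ℂ :=
  Sum.elim (fun o => o.elim p.t p.x) fun o => p.lam.rep o / p.lam.rep k

theorem eval_eq_pow_mul_eval_chart {F : MvPolynomial (Vars n ι) ℂ} {N : ℕ}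
    (hF : F.IsWeightedHomogeneous (lamWeight n ι) N) {k : Option ι} {p : MixedSpace n ι}
    (hk : p.lam.rep k ≠ 0) :
    MvPolynomial.eval p.coords F = p.lam.rep k ^ N * MvPolynomial.eval (chart k p) F := by
  rw [MvPolynomial.eval_eq, MvPolynomial.eval_eq, Finset.mul_sum]
  refine Finset.sum_congr rfl fun s hs => ?_
  have h1 : Finsupp.weight (lamWeight n ι) s = N := hF (MvPolynomial.mem_support_iff.1 hs)
  have h2 : p.lam.rep k ^ N = ∏ i ∈ s.support, (p.lam.rep k ^ lamWeight n ι i) ^ s i := by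
    simp only [← pow_mul]
    rw [Finset.prod_pow_eq_pow_sum, ← h1, Finsupp.weight_apply, Finsupp.sum]
    simp [mul_comm]
  rw [h2, mul_left_comm, ← Finset.prod_mul_distrib]
  congr 1
  refine Finset.prod_congr rfl fun i _ => ?_
  rw [← mul_pow]
  congr 1
  rcases i with i | i
  · simp [coords, chart]
  · simp [coords, chart, mul_div_cancel₀ _ hk]

/-- Clearing denominators turns a polynomial on the chart `λ_k ≠ 0` into one that is homogeneous
in `λ`, of any sufficiently large degree. -/
theorem exists_homogenization (k : Option ι) (F : MvPolynomial (Vars n ι) ℂ) :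
    ∃ N : ℕ, ∀ M ≥ N, ∃ H : MvPolynomial (Vars n ι) ℂ,
      H.IsWeightedHomogeneous (lamWeight n ι) M ∧ ∀ p : MixedSpace n ι, p.lam.rep k ≠ 0 →
        MvPolynomial.eval p.coords H = p.lam.rep k ^ M * MvPolynomial.eval (chart k p) F := by
  induction F using MvPolynomial.induction_on with
  | C c =>
    refine ⟨0, fun M _ => ⟨MvPolynomial.C c * MvPolynomial.X (Sum.inr k) ^ M, ?_, fun p _ => ?_⟩⟩
    · have := (MvPolynomial.isWeightedHomogeneous_C (lamWeight n ι) c).mul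
        ((MvPolynomial.isWeightedHomogeneous_X ℂ (lamWeight n ι) (Sum.inr k)).pow M)
      simpa using this
    · simp [coords, mul_comm]
  | add F G hF hG =>
    obtain ⟨N₁, h₁⟩ := hF
    obtain ⟨N₂, h₂⟩ := hG
    refine ⟨max N₁ N₂, fun M hM => ?_⟩
    obtain ⟨H₁, hom₁, e₁⟩ := h₁ M ((le_max_left _ _).trans hM)
    obtain ⟨H₂, hom₂, e₂⟩ := h₂ M ((le_max_right _ _).trans hM)
    exact ⟨H₁ + H₂, hom₁.add hom₂, fun p hp => by rw [map_add, e₁ p hp, e₂ p hp, map_add, mul_add]⟩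
  | mul_X F i hF =>
    obtain ⟨N, h⟩ := hF
    rcases i with i | i
    · refine ⟨N, fun M hM => ?_⟩
      obtain ⟨H, hom, e⟩ := h M hM
      refine ⟨H * MvPolynomial.X (Sum.inl i), ?_, fun p hp => ?_⟩
      · simpa using hom.mul (MvPolynomial.isWeightedHomogeneous_X ℂ (lamWeight n ι) (Sum.inl i))
      · rw [map_mul, e p hp, map_mul, mul_assoc]
        simp [coords, chart]
    · refine ⟨N + 1, fun M hM => ?_⟩
      obtain ⟨M, rfl⟩ : ∃ M', M = M' + 1 := ⟨M - 1, by omega⟩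
      obtain ⟨H, hom, e⟩ := h M (by omega)
      refine ⟨H * MvPolynomial.X (Sum.inr i), ?_, fun p hp => ?_⟩
      · simpa using hom.mul (MvPolynomial.isWeightedHomogeneous_X ℂ (lamWeight n ι) (Sum.inr i))
      · rw [map_mul, e p hp, map_mul]
        simp only [MvPolynomial.eval_X, coords, chart, Sum.elim_inr]
        field_simp
        ring

theorem isClosed_chart (k : Option ι) (F : MvPolynomial (Vars n ι) ℂ) :
    IsClosed {p : MixedSpace n ι | p.lam.rep k = 0 ∨ MvPolynomial.eval (chart k p) F = 0} := by
  obtain ⟨N, h⟩ := exists_homogenization k F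
  obtain ⟨H, hom, e⟩ := h N le_rfl
  have h1 := isClosed_zeros (F := H * MvPolynomial.X (Sum.inr k)) ⟨N + 1, by
    simpa using hom.mul (MvPolynomial.isWeightedHomogeneous_X ℂ (lamWeight n ι) (Sum.inr k))⟩
  convert h1 using 1
  ext p
  have h2 : p.coords (Sum.inr k) = p.lam.rep k := rfl
  by_cases hp : p.lam.rep k = 0
  · simp [hp, h2]
  · simp [hp, h2, e p hp]

theorem isClosed_rep_eq_zero (k : Option ι) :
    IsClosed {p : MixedSpace n ι | p.lam.rep k = 0} := by
  simpa using isClosed_chart (n := n) k 1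

theorem isClosed_t_eq (t₀ : ℂ) : IsClosed {p : MixedSpace n ι | p.t = t₀} := by
  have := isClosed_zeros (n := n) (ι := ι)
    (F := MvPolynomial.X (Sum.inl none) - MvPolynomial.C t₀) ⟨0,
      (MvPolynomial.isWeightedHomogeneous_X ℂ (lamWeight n ι) (Sum.inl none)).sub
        (MvPolynomial.isWeightedHomogeneous_C _ _)⟩
  simpa [coords, sub_eq_zero] using this

theorem exists_rep_ne_zero (p : MixedSpace n ι) : ∃ k, p.lam.rep k ≠ 0 :=
  Function.ne_iff.1 p.lam.rep_nonzero

theorem eq_of_proportional {p r : MixedSpace n ι} (ht : p.t = r.t) (hx : p.x = r.x)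
    (h : ∀ a b, p.lam.rep a * r.lam.rep b = p.lam.rep b * r.lam.rep a) : p = r := by
  refine MixedSpace.ext ht hx ?_
  obtain ⟨k, hk⟩ := exists_rep_ne_zero r
  rw [← p.lam.mk_rep, ← r.lam.mk_rep, Projectivization.mk_eq_mk_iff']
  refine ⟨p.lam.rep k / r.lam.rep k, funext fun a => ?_⟩
  rw [Pi.smul_apply, smul_eq_mul, div_mul_eq_mul_div, div_eq_iff hk, h]

theorem eq_of_chart_eq {k : Option ι} {p r : MixedSpace n ι} (hp : p.lam.rep k ≠ 0)
    (hr : r.lam.rep k ≠ 0) (h : chart k p = chart k r) : p = r := by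
  refine eq_of_proportional (congrFun h (Sum.inl none))
    (funext fun j => congrFun h (Sum.inl (some j))) fun a b => ?_
  have ha : p.lam.rep a / p.lam.rep k = r.lam.rep a / r.lam.rep k := congrFun h (Sum.inr a)
  have hb : p.lam.rep b / p.lam.rep k = r.lam.rep b / r.lam.rep k := congrFun h (Sum.inr b)
  rw [div_eq_div_iff hp hr] at ha hb
  have : p.lam.rep k * r.lam.rep k ≠ 0 := mul_ne_zero hp hr
  apply mul_left_cancel₀ this
  linear_combination (p.lam.rep k * r.lam.rep b) * ha - p.lam.rep k * r.lam.rep a * hb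

theorem isZariskiClosed_singleton (p : MixedSpace n ι) :
    IsZariskiClosed ({p} : Set (MixedSpace n ι)) := by
  refine ⟨{F | ∃ o, F = MvPolynomial.X (Sum.inl o) - MvPolynomial.C (p.coords (Sum.inl o))} ∪
    {F | ∃ a b, F = MvPolynomial.X (Sum.inr a) * MvPolynomial.C (p.lam.rep b) -
      MvPolynomial.X (Sum.inr b) * MvPolynomial.C (p.lam.rep a)}, ?_, ?_⟩
  · rintro F (⟨o, rfl⟩ | ⟨a, b, rfl⟩)
    · exact ⟨0, (MvPolynomial.isWeightedHomogeneous_X ℂ (lamWeight n ι) (Sum.inl o)).sub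
        (MvPolynomial.isWeightedHomogeneous_C _ _)⟩
    · exact ⟨1, ((MvPolynomial.isWeightedHomogeneous_X ℂ (lamWeight n ι) (Sum.inr a)).mul
        (MvPolynomial.isWeightedHomogeneous_C _ _)).sub
        ((MvPolynomial.isWeightedHomogeneous_X ℂ (lamWeight n ι) (Sum.inr b)).mul
        (MvPolynomial.isWeightedHomogeneous_C _ _))⟩
  · ext r
    constructor
    · rintro rfl F (⟨o, rfl⟩ | ⟨a, b, rfl⟩)
      · simp
      · simp [coords, mul_comm]
    · intro h
      have h1 : ∀ o, r.coords (Sum.inl o) = p.coords (Sum.inl o) := fun o => by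
        have := h _ (.inl ⟨o, rfl⟩)
        simpa [sub_eq_zero] using this
      refine eq_of_proportional (h1 none) (funext fun j => h1 (some j)) fun a b => ?_
      have := h _ (.inr ⟨a, b, rfl⟩)
      simpa [sub_eq_zero, coords] using this

instance : T1Space (MixedSpace n ι) := ⟨fun p => isClosed_iff.2 (isZariskiClosed_singleton p)⟩

instance [Finite ι] : TopologicalSpace.NoetherianSpace (MixedSpace n ι) := by
  refine ((TopologicalSpace.noetherianSpace_TFAE (MixedSpace n ι)).out 0 1 :
    TopologicalSpace.NoetherianSpace _ ↔ WellFoundedLT (TopologicalSpace.Closeds _)).2 ?_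
  -- Closed sets embed into the ideals of a Noetherian ring, with the order reversed.
  let I : TopologicalSpace.Closeds (MixedSpace n ι) → (Ideal (MvPolynomial (Vars n ι) ℂ))ᵒᵈ :=
    fun Z => OrderDual.toDual
      (Ideal.span {F | ∀ p ∈ Z, MvPolynomial.eval p.coords F = 0})
  have hI : StrictMono I := by
    refine Monotone.strictMono_of_injective (fun Z Z' h => ?_) fun Z Z' h => ?_
    · exact Ideal.span_mono fun F hF p hp => hF p (h hp)
    · have key : ∀ Z Z' : TopologicalSpace.Closeds (MixedSpace n ι), I Z = I Z' → Z ≤ Z' := by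
        intro Z Z' h p hp
        obtain ⟨P, hP, hZ'⟩ := isClosed_iff.1 Z'.isClosed
        change p ∈ (Z' : Set _)
        rw [hZ']
        intro F hF
        have h1 : F ∈ Ideal.span {F | ∀ p ∈ Z', MvPolynomial.eval p.coords F = 0} :=
          Ideal.subset_span fun r hr => by
            change r ∈ (Z' : Set _) at hr
            rw [hZ'] at hr
            exact hr F hF
        have h2 : F ∈ Ideal.span {F | ∀ p ∈ Z, MvPolynomial.eval p.coords F = 0} := by
          have : Ideal.span {F | ∀ p ∈ Z, MvPolynomial.eval p.coords F = 0} =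
            Ideal.span {F | ∀ p ∈ Z', MvPolynomial.eval p.coords F = 0} := h
          rwa [this]
        have h3 : Ideal.span {F | ∀ p ∈ Z, MvPolynomial.eval p.coords F = 0} ≤
            RingHom.ker (MvPolynomial.eval p.coords) :=
          Ideal.span_le.2 fun F hF => hF p hp
        exact h3 h2
      exact le_antisymm (key _ _ h) (key _ _ h.symm)
  exact hI.wellFoundedLT

/-! ### Coordinate rings of irreducible sets -/

variable {W : Set (MixedSpace n ι)} {k : Option ι}

/-- The ideal of the polynomials vanishing on the part of `W` in the chart `λ_k ≠ 0`. -/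
noncomputable def chartIdeal (W : Set (MixedSpace n ι)) (k : Option ι) :
    Ideal (MvPolynomial (Vars n ι) ℂ) :=
  ⨅ p : {p : MixedSpace n ι // p ∈ W ∧ p.lam.rep k ≠ 0},
    RingHom.ker (MvPolynomial.eval (chart k p.1))

theorem mem_chartIdeal {F : MvPolynomial (Vars n ι) ℂ} :
    F ∈ chartIdeal W k ↔
      ∀ p ∈ W, p.lam.rep k ≠ 0 → MvPolynomial.eval (chart k p) F = 0 := by
  simp [chartIdeal, RingHom.mem_ker]

theorem subset_or_of_subset_union (hW : IsIrreducible W) {A B : Set (MixedSpace n ι)}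
    (hA : IsClosed A) (hB : IsClosed B) (h : W ⊆ A ∪ B) : W ⊆ A ∨ W ⊆ B :=
  isPreirreducible_iff_isClosed_union_isClosed.1 hW.isPreirreducible A B hA hB h

theorem chartIdeal_isPrime (hW : IsIrreducible W) (hk : ∃ p ∈ W, p.lam.rep k ≠ 0) :
    (chartIdeal W k).IsPrime := by
  refine ⟨?_, fun {F G} hFG => ?_⟩
  · obtain ⟨p, hp, hpk⟩ := hk
    rw [Ideal.ne_top_iff_one, mem_chartIdeal]
    exact fun h => by simpa using h p hp hpk
  · rw [mem_chartIdeal] at hFG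
    rcases subset_or_of_subset_union hW (isClosed_chart k F) (isClosed_chart k G) fun p hp => by
      by_cases hpk : p.lam.rep k = 0
      · exact .inl (.inl hpk)
      · have := hFG p hp hpk
        rw [map_mul, mul_eq_zero] at this
        exact this.imp .inr .inr with h | h
    · exact .inl (mem_chartIdeal.2 fun p hp hpk => (h hp).resolve_left hpk)
    · exact .inr (mem_chartIdeal.2 fun p hp hpk => (h hp).resolve_left hpk)

/-- In a chart, a closed set is the zero set of its ideal. -/
theorem mem_of_forall_mem_chartIdeal (hW : IsClosed W) {p : MixedSpace n ι}
    (hpk : p.lam.rep k ≠ 0) (h : ∀ F ∈ chartIdeal W k, MvPolynomial.eval (chart k p) F = 0) :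
    p ∈ W := by
  obtain ⟨P, hP, rfl⟩ := isClosed_iff.1 hW
  intro F hF
  obtain ⟨N, hN⟩ := hP F hF
  rw [eval_eq_pow_mul_eval_chart hN hpk, h F, mul_zero]
  refine mem_chartIdeal.2 fun r hr hrk => ?_
  have := hr F hF
  rw [eval_eq_pow_mul_eval_chart hN hrk] at this
  exact (mul_eq_zero.1 this).resolve_left (pow_ne_zero _ hrk)

/-- A chart coordinate that is algebraic over `ℂ` on an irreducible set is constant. -/
theorem chart_eq_of_aeval_mem (hW : IsIrreducible W) {i : Vars n ι} {P : Polynomial ℂ} (hP : P ≠ 0)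
    (h : Polynomial.aeval (MvPolynomial.X i) P ∈ chartIdeal W k) {p : MixedSpace n ι}
    (hp : p ∈ W) (hpk : p.lam.rep k ≠ 0) :
    ∀ r ∈ W, r.lam.rep k ≠ 0 → chart k r i = chart k p i := by
  have := chartIdeal_isPrime hW ⟨p, hp, hpk⟩
  have hs := IsAlgClosed.splits P
  obtain ⟨c, hc⟩ : ∃ c : ℂ, MvPolynomial.X i - MvPolynomial.C c ∈ chartIdeal W k := by
    rw [hs.eq_prod_roots, map_mul, Polynomial.aeval_C] at h
    rcases this.mem_or_mem h with h | h
    · exfalso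
      have := mem_chartIdeal.1 h p hp hpk
      simp [hP] at this
    · rw [map_multiset_prod, Multiset.map_map] at h
      obtain ⟨y, hy, hc⟩ := (this.multiset_prod_mem_iff_exists_mem _).1 h
      obtain ⟨c, -, rfl⟩ := Multiset.mem_map.1 hy
      exact ⟨c, by simpa using hc⟩
  have hc' := fun r hr hrk => by simpa [sub_eq_zero] using mem_chartIdeal.1 hc r hr hrk
  intro r hr hrk
  rw [hc' r hr hrk, hc' p hp hpk]

/-- If every chart of `W` has transcendence degree at most one, in the sense that two functions
always satisfy a relation, then the irreducible closed proper subsets of `W` are points. -/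
theorem exists_eq_singleton (hW : IsIrreducible W)
    (hrel : ∀ k, (∃ p ∈ W, p.lam.rep k ≠ 0) → ∀ (i : Vars n ι), ∀ f ∉ chartIdeal W k,
      ∃ Q : Polynomial (Polynomial ℂ), Q.coeff 0 ≠ 0 ∧
        Q.eval₂ (Polynomial.aeval (MvPolynomial.X i)).toRingHom f ∈ chartIdeal W k)
    {Z : Set (MixedSpace n ι)} (hZ : IsIrreducible Z) (hZc : IsClosed Z) (hZW : Z ⊆ W)
    (hne : Z ≠ W) : ∃ p, Z = {p} := by
  obtain ⟨p, hp⟩ := hZ.nonempty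
  obtain ⟨k, hpk⟩ := exists_rep_ne_zero p
  -- A function vanishing on `Z` but not on `W`: the relations specialize to equations on `Z`.
  obtain ⟨F₀, hF₀Z, hF₀W⟩ : ∃ F₀ ∈ chartIdeal Z k, F₀ ∉ chartIdeal W k := by
    by_contra! hcon
    refine hne (hZW.antisymm ?_)
    rcases subset_or_of_subset_union hW hZc (isClosed_rep_eq_zero k) fun r hr => by
      by_cases hrk : r.lam.rep k = 0
      · exact .inr hrk
      · exact .inl (mem_of_forall_mem_chartIdeal hZc hrk fun F hF =>
          mem_chartIdeal.1 (hcon F hF) r hr hrk) with h | h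
    · exact h
    · exact absurd (h (hZW hp)) hpk
  have hconst : ∀ r ∈ Z, r.lam.rep k ≠ 0 → r = p := by
    intro r hr hrk
    refine eq_of_chart_eq hrk hpk (funext fun i => ?_)
    obtain ⟨Q, hQ0, hQ⟩ := hrel k ⟨p, hZW hp, hpk⟩ i F₀ hF₀W
    refine chart_eq_of_aeval_mem hZ hQ0 (mem_chartIdeal.2 fun s hs hsk => ?_) hp hpk r hr hrk
    have h1 := mem_chartIdeal.1 hQ s (hZW hs) hsk
    rw [Polynomial.hom_eval₂, mem_chartIdeal.1 hF₀Z s hs hsk, Polynomial.eval₂_at_zero] at h1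
    exact h1
  refine ⟨p, (Set.singleton_subset_iff.2 hp).antisymm' ?_⟩
  rcases subset_or_of_subset_union hZ (isClosed_singleton (x := p)) (isClosed_rep_eq_zero k)
    fun r hr => by
      by_cases hrk : r.lam.rep k = 0
      · exact .inr hrk
      · exact .inl (hconst r hr hrk) with h | h
  · exact h
  · exact absurd (h hp) hpk

/-- The dimension of an irreducible closed set all of whose irreducible closed proper subsets are
points, and which is not a point itself. -/
theorem topologicalKrullDim_eq_one (hWc : IsClosed W)
    (hpt : ∀ Z, IsIrreducible Z → IsClosed Z → Z ⊆ W → Z ≠ W → ∃ p, Z = {p})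
    (hW : IsIrreducible W) (hnt : W.Nontrivial) : topologicalKrullDim W = 1 := by
  apply le_antisymm
  · refine Order.krullDim_le_one_iff.2 fun Z => ?_
    have hZi : IsIrreducible ((↑) '' (Z : Set W) : Set (MixedSpace n ι)) :=
      Z.isIrreducible.image _ continuous_subtype_val.continuousOn
    have hZc : IsClosed ((↑) '' (Z : Set W) : Set (MixedSpace n ι)) :=
      hWc.isClosedEmbedding_subtypeVal.isClosedMap _ Z.isClosed
    by_cases hZW : ((↑) '' (Z : Set W) : Set (MixedSpace n ι)) = W
    · right
      intro Z' _ r _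
      have : (r : MixedSpace n ι) ∈ ((↑) '' (Z : Set W) : Set (MixedSpace n ι)) := by
        rw [hZW]; exact r.2
      obtain ⟨s, hs, hsr⟩ := this
      rwa [← Subtype.ext hsr]
    · left
      obtain ⟨p, hp⟩ := hpt _ hZi hZc (by rintro _ ⟨r, -, rfl⟩; exact r.2) hZW
      intro Z' hZ' r hr
      obtain ⟨s, hs⟩ := Z'.isIrreducible.nonempty
      have h1 : ∀ u : W, u ∈ (Z : Set W) → (u : MixedSpace n ι) = p := fun u hu => by
        have : (u : MixedSpace n ι) ∈ ((↑) '' (Z : Set W) : Set (MixedSpace n ι)) := ⟨u, hu, rfl⟩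
        rwa [hp] at this
      have : r = s := Subtype.ext ((h1 r hr).trans (h1 s (hZ' hs)).symm)
      rw [this]
      exact hs
  · refine Order.one_le_krullDim_iff.2 ?_
    obtain ⟨p, hp, r, hr, hne⟩ := hnt
    have hWi : IrreducibleSpace W := (isIrreducible_iff_irreducibleSpace).1 hW
    refine ⟨⟨{⟨p, hp⟩}, isIrreducible_singleton, isClosed_singleton⟩,
      ⟨Set.univ, IrreducibleSpace.isIrreducible_univ W, isClosed_univ⟩, ?_⟩
    refine lt_of_le_of_ne (fun _ _ => Set.mem_univ _) fun h => hne ?_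
    have h1 : (⟨r, hr⟩ : W) ∈ ({⟨p, hp⟩} : Set W) := by
      have := congrArg TopologicalSpace.IrreducibleCloseds.carrier h
      simp only at this
      rw [this]
      trivial
    exact (congrArg Subtype.val h1).symm

end MixedSpace

/-! ### The critical point equations and their generic solutions -/

open MvPolynomial (X C aeval eval)

section LamFree

variable {n : ℕ} {ι : Type}

/-- The polynomials of degree `0` in `λ`. -/
noncomputable def lamFree (n : ℕ) (ι : Type) : Subalgebra ℂ (MvPolynomial (Vars n ι) ℂ) where
  carrier := {F | F.IsWeightedHomogeneous (MixedSpace.lamWeight n ι) 0}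
  mul_mem' h h' := by simpa using h.mul h'
  add_mem' h h' := h.add h'
  algebraMap_mem' c := MvPolynomial.isWeightedHomogeneous_C _ c

theorem X_mem_lamFree (o : Option (Fin n)) : X (Sum.inl o) ∈ lamFree n ι :=
  MvPolynomial.isWeightedHomogeneous_X ℂ (MixedSpace.lamWeight n ι) (Sum.inl o)

theorem aeval_mem_lamFree (p : MvPolynomial (Fin n) ℂ) :
    aeval (fun j => X (Sum.inl (some j))) p ∈ lamFree n ι := by
  have := MvPolynomial.comp_aeval_apply (fun j => (⟨_, X_mem_lamFree (some j)⟩ : lamFree n ι))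
    (lamFree n ι).val p
  exact this ▸ Subtype.property _

theorem polynomial_aeval_mem_lamFree (p : Polynomial ℂ) (j : Fin n) :
    Polynomial.aeval (X (Sum.inl (some j))) p ∈ lamFree n ι := by
  have := Polynomial.aeval_algHom_apply (lamFree n ι).val ⟨_, X_mem_lamFree (some j)⟩ p
  exact this ▸ Subtype.property _

theorem isWeightedHomogeneous_X_mul (o : Option ι) {F : MvPolynomial (Vars n ι) ℂ}
    (hF : F ∈ lamFree n ι) :
    (X (Sum.inr o) * F).IsWeightedHomogeneous (MixedSpace.lamWeight n ι) 1 := by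
  simpa using (MvPolynomial.isWeightedHomogeneous_X ℂ (MixedSpace.lamWeight n ι)
    (Sum.inr o)).mul hF

end LamFree

section CriticalPolynomials

variable {n : ℕ} {ι : Type}

/-- The left hand side of the constraint equation `i` as a polynomial in `t, x`. -/
noncomputable def constraintPoly (a₀ : ι → ℂ) (a : Option ι → Fin n → ℂ) (T : Polynomial ℂ)
    (ε : ι → ℤˣ) (P : ι → MvPolynomial (Fin n) ℂ) (i : ι) : MvPolynomial (Vars n ι) ℂ :=
  X (Sum.inl none) * aeval (fun j => X (Sum.inl (some j))) (P i) +
    C ((ε i : ℤ) : ℂ) * (1 - X (Sum.inl none)) * (C (a₀ i) +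
      ∑ j, C (a (some i) j) * (Polynomial.aeval (X (Sum.inl (some j))) T + 1))

variable {a₀ : ι → ℂ} {a : Option ι → Fin n → ℂ} {T : Polynomial ℂ}
  {ε : ι → ℤˣ} {P : ι → MvPolynomial (Fin n) ℂ} {g : MvPolynomial (Fin n) ℂ}

theorem constraintPoly_mem_lamFree (i : ι) : constraintPoly a₀ a T ε P i ∈ lamFree n ι := by
  have hC : ∀ c : ℂ, C c ∈ lamFree n ι := (lamFree n ι).algebraMap_mem
  exact add_mem (mul_mem (X_mem_lamFree _) (aeval_mem_lamFree _)) <|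
    mul_mem (mul_mem (hC _) (sub_mem (one_mem _) (X_mem_lamFree _))) <|
    add_mem (hC _) (sum_mem fun j _ =>
      mul_mem (hC _) (add_mem (polynomial_aeval_mem_lamFree _ _) (one_mem _)))

variable [Fintype ι]

/-- The difference of the two sides of the gradient equation `j` as a polynomial in `t, x, λ`. -/
noncomputable def stationaryPoly (a : Option ι → Fin n → ℂ) (T : Polynomial ℂ)
    (ε : ι → ℤˣ) (P : ι → MvPolynomial (Fin n) ℂ) (g : MvPolynomial (Fin n) ℂ) (j : Fin n) :
    MvPolynomial (Vars n ι) ℂ :=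
  X (Sum.inr none) * (X (Sum.inl none) *
      aeval (fun j => X (Sum.inl (some j))) (MvPolynomial.pderiv j g) + (1 - X (Sum.inl none)) *
        (C (a none j) * Polynomial.aeval (X (Sum.inl (some j))) T.derivative)) -
    ∑ i, X (Sum.inr (some i)) * (X (Sum.inl none) *
      aeval (fun j => X (Sum.inl (some j))) (MvPolynomial.pderiv j (P i)) +
        C ((ε i : ℤ) : ℂ) * (1 - X (Sum.inl none)) *
          (C (a (some i) j) * Polynomial.aeval (X (Sum.inl (some j))) T.derivative))

theorem isCritical_iff {K : Type*} [CommRing K] [Algebra ℂ K]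
    (φ : MvPolynomial (Vars n ι) ℂ →ₐ[ℂ] K) :
    IsCritical a₀ a T ε P g (φ (X (Sum.inl none))) (fun j => φ (X (Sum.inl (some j))))
        (fun o => φ (X (Sum.inr o))) ↔
      (∀ i, φ (constraintPoly a₀ a T ε P i) = 0) ∧ ∀ j, φ (stationaryPoly a T ε P g j) = 0 := by
  have hC : ∀ c : ℂ, φ (C c) = algebraMap ℂ K c := fun c => φ.commutes c
  have hM : ∀ p : MvPolynomial (Fin n) ℂ, φ (aeval (fun j => X (Sum.inl (some j))) p) =
      aeval (fun j => φ (X (Sum.inl (some j)))) p := fun p =>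
    MvPolynomial.comp_aeval_apply _ φ p
  have hP : ∀ (p : Polynomial ℂ) (y : MvPolynomial (Vars n ι) ℂ),
      φ (Polynomial.aeval y p) = Polynomial.aeval (φ y) p := fun p y =>
    (Polynomial.aeval_algHom_apply φ y p).symm
  constructor
  · intro h
    refine ⟨fun i => ?_, fun j => ?_⟩
    · have := h.constraint i
      simpa only [constraintPoly, map_add, map_mul, map_sub, map_sum, map_one, hC, hM, hP,
        map_intCast] using this
    · have := h.stationary j
      simpa only [stationaryPoly, map_add, map_mul, map_sub, map_sum, map_one, hC, hM, hP,
        map_intCast, sub_eq_zero] using this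
  · rintro ⟨h1, h2⟩
    refine ⟨fun i => ?_, fun j => ?_⟩
    · have := h1 i
      simpa only [constraintPoly, map_add, map_mul, map_sub, map_sum, map_one, hC, hM, hP,
        map_intCast] using this
    · have := h2 j
      simpa only [stationaryPoly, map_add, map_mul, map_sub, map_sum, map_one, hC, hM, hP,
        map_intCast, sub_eq_zero] using this

theorem stationaryPoly_isWeightedHomogeneous (j : Fin n) :
    (stationaryPoly a T ε P g j).IsWeightedHomogeneous (MixedSpace.lamWeight n ι) 1 := by
  have hC : ∀ c : ℂ, C c ∈ lamFree n ι := (lamFree n ι).algebraMap_mem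
  refine MvPolynomial.IsWeightedHomogeneous.sub ?_ ?_
  · exact isWeightedHomogeneous_X_mul _ <| add_mem
      (mul_mem (X_mem_lamFree _) (aeval_mem_lamFree _)) <|
      mul_mem (sub_mem (one_mem _) (X_mem_lamFree _))
        (mul_mem (hC _) (polynomial_aeval_mem_lamFree _ _))
  · refine Submodule.sum_mem (MvPolynomial.weightedHomogeneousSubmodule ℂ _ 1) fun i _ => ?_
    exact isWeightedHomogeneous_X_mul _ <| add_mem
      (mul_mem (X_mem_lamFree _) (aeval_mem_lamFree _)) <|
      mul_mem (mul_mem (hC _) (sub_mem (one_mem _) (X_mem_lamFree _)))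
        (mul_mem (hC _) (polynomial_aeval_mem_lamFree _ _))

variable (a₀ a T ε P g) in
/-- The points of the mixed space that solve the critical point equations. -/
def criticalSet : Set (MixedSpace n ι) :=
  {p | IsCritical a₀ a T ε P g p.t p.x p.lam.rep}

theorem mem_criticalSet_iff {p : MixedSpace n ι} : p ∈ criticalSet a₀ a T ε P g ↔
    (∀ i, eval p.coords (constraintPoly a₀ a T ε P i) = 0) ∧
      ∀ j, eval p.coords (stationaryPoly a T ε P g j) = 0 := by
  have := isCritical_iff (a₀ := a₀) (a := a) (T := T) (ε := ε) (P := P) (g := g)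
    (aeval p.coords : MvPolynomial (Vars n ι) ℂ →ₐ[ℂ] ℂ)
  simp only [MvPolynomial.aeval_X, MvPolynomial.aeval_eq_eval] at this
  exact this

theorem isClosed_criticalSet : IsClosed (criticalSet a₀ a T ε P g) := by
  have h : criticalSet a₀ a T ε P g =
      (⋂ i, {p | eval p.coords (constraintPoly a₀ a T ε P i) = 0}) ∩
        ⋂ j, {p | eval p.coords (stationaryPoly a T ε P g j) = 0} := by
    ext p
    simp [mem_criticalSet_iff]
  rw [h]
  exact (isClosed_iInter fun i =>
    MixedSpace.isClosed_zeros ⟨0, constraintPoly_mem_lamFree i⟩).inter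
    (isClosed_iInter fun j =>
      MixedSpace.isClosed_zeros ⟨1, stationaryPoly_isWeightedHomogeneous j⟩)

end CriticalPolynomials

namespace MixedSpace

variable {n : ℕ} {ι : Type} {W : Set (MixedSpace n ι)} {k : Option ι}

theorem X_sub_one_mem_chartIdeal : X (Sum.inr k) - 1 ∈ chartIdeal W k :=
  mem_chartIdeal.2 fun p _ hk => by simp [chart, div_self hk]

/-- The generic point of an irreducible set, in the chart `λ_k ≠ 0`: the field `K` is the function
field of the set, and `φ` evaluates polynomials at the generic point. -/
theorem exists_genericPoint (hW : IsIrreducible W) (hk : ∃ p ∈ W, p.lam.rep k ≠ 0) :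
    ∃ (K : Type) (_ : Field K) (_ : Algebra ℂ K) (φ : MvPolynomial (Vars n ι) ℂ →ₐ[ℂ] K),
      (∀ F, φ F = 0 ↔ F ∈ chartIdeal W k) ∧ ∀ z, ∃ F H, z = φ F / φ H := by
  have := chartIdeal_isPrime hW hk
  let A := MvPolynomial (Vars n ι) ℂ ⧸ chartIdeal W k
  refine ⟨FractionRing A, inferInstance, inferInstance,
    (IsScalarTower.toAlgHom ℂ A (FractionRing A)).comp (Ideal.Quotient.mkₐ ℂ _), fun F => ?_,
    fun z => ?_⟩
  · rw [← Ideal.Quotient.eq_zero_iff_mem]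
    exact map_eq_zero_iff (algebraMap A (FractionRing A)) (IsFractionRing.injective A _)
  · obtain ⟨x, y, -, rfl⟩ := IsFractionRing.div_surjective (A := A) z
    obtain ⟨F, rfl⟩ := Ideal.Quotient.mk_surjective x
    obtain ⟨H, rfl⟩ := Ideal.Quotient.mk_surjective y
    exact ⟨F, H, rfl⟩

/-- If `t` is algebraic over `ℂ` on one chart of an irreducible set, it is constant on the set. -/
theorem exists_t_eq_of_aeval_mem (hW : IsIrreducible W) {P : Polynomial ℂ} (hP : P ≠ 0)
    (h : Polynomial.aeval (X (Sum.inl none)) P ∈ chartIdeal W k)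
    (hk : ∃ p ∈ W, p.lam.rep k ≠ 0) : ∃ t₀ : ℂ, ∀ p ∈ W, p.t = t₀ := by
  obtain ⟨p, hp, hpk⟩ := hk
  have hc := chart_eq_of_aeval_mem hW hP h hp hpk
  refine ⟨p.t, ?_⟩
  rcases subset_or_of_subset_union hW (isClosed_t_eq p.t) (isClosed_rep_eq_zero k) fun r hr => by
    by_cases hrk : r.lam.rep k = 0
    · exact .inr hrk
    · exact .inl (hc r hr hrk) with h | h
  · exact h
  · exact absurd (h hp) hpk

/-- A zero of the ideal of `W` in the chart `λ_k ≠ 0` comes from a point of `W`. -/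
theorem exists_point_of_zero (hWc : IsClosed W) [Finite ι] {v : Vars n ι → ℂ}
    (hv : ∀ F ∈ chartIdeal W k, eval v F = 0) : ∃ p ∈ W, p.t = v (Sum.inl none) := by
  have hvk : v (Sum.inr k) = 1 := by
    simpa [sub_eq_zero] using hv _ X_sub_one_mem_chartIdeal
  have hne : (fun o => v (Sum.inr o)) ≠ 0 := Function.ne_iff.2 ⟨k, by simp [hvk]⟩
  set p : MixedSpace n ι := ⟨v (Sum.inl none), fun j => v (Sum.inl (some j)),
    Projectivization.mk ℂ _ hne⟩ with hp
  obtain ⟨c, hc⟩ := Projectivization.exists_smul_eq_mk_rep ℂ _ hne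
  have hrep : ∀ o, p.lam.rep o = (c : ℂ) * v (Sum.inr o) := fun o => (congrFun hc o).symm
  have hpk : p.lam.rep k ≠ 0 := by
    rw [hrep, hvk, mul_one]
    exact c.ne_zero
  have hchart : chart k p = v := by
    funext i
    rcases i with (_ | j) | o
    · rfl
    · rfl
    · change p.lam.rep o / p.lam.rep k = _
      rw [hrep, hrep, hvk, mul_one, mul_div_cancel_left₀ _ c.ne_zero]
  exact ⟨p, mem_of_forall_mem_chartIdeal hWc hpk (by rwa [hchart]), rfl⟩

end MixedSpace

section Core

open MixedSpace

variable {n d : ℕ} {ι : Type} [Fintype ι] {Q : Option ι → ℕ}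
  {ε : ι → ℤˣ} {P : ι → MvPolynomial (Fin n) ℂ} {g : MvPolynomial (Fin n) ℂ}
  {W : Set (MixedSpace n ι)} {k : Option ι}

/-- The generic point of a set of critical points is a critical point. -/
theorem isCritical_genericPoint {a₀ : ι → ℂ} {a : Option ι → Fin n → ℂ} {T : Polynomial ℂ}
    (hW : W ⊆ criticalSet a₀ a T ε P g) {K : Type*} [Field K] [Algebra ℂ K]
    {φ : MvPolynomial (Vars n ι) ℂ →ₐ[ℂ] K} (hφ : ∀ F ∈ chartIdeal W k, φ F = 0) :
    IsCritical a₀ a T ε P g (φ (X (Sum.inl none))) (fun j => φ (X (Sum.inl (some j))))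
      (fun o => φ (X (Sum.inr o))) := by
  rw [isCritical_iff]
  refine ⟨fun i => hφ _ (mem_chartIdeal.2 fun p hp hpk => ?_),
    fun j => hφ _ (mem_chartIdeal.2 fun p hp hpk => ?_)⟩
  · have := (mem_criticalSet_iff.1 (hW hp)).1 i
    rw [eval_eq_pow_mul_eval_chart (constraintPoly_mem_lamFree i) hpk] at this
    exact (mul_eq_zero.1 this).resolve_left (pow_ne_zero _ hpk)
  · have := (mem_criticalSet_iff.1 (hW hp)).2 j
    rw [eval_eq_pow_mul_eval_chart (stationaryPoly_isWeightedHomogeneous j) hpk] at this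
    exact (mul_eq_zero.1 this).resolve_left (pow_ne_zero _ hpk)

/-- `W` is an irreducible closed set of critical points of the deformation on which `t` is not
constant, and the data of the deformation satisfy the assumptions on degrees and on the nodes. That
such a set has dimension one is a consequence. -/
structure IsCurve (Q : Option ι → ℕ) (d : ℕ) (ε : ι → ℤˣ) (P : ι → MvPolynomial (Fin n) ℂ)
    (g : MvPolynomial (Fin n) ℂ) (W : Set (MixedSpace n ι)) : Prop where
  degree_pos : 0 < d
  injective : Function.Injective Q
  lt_node : ∀ o, n < Q o
  prime : ∀ i, (Q (some i)).Prime
  degree_constraint : ∀ i, (P i).totalDegree ≤ d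
  degree_objective : g.totalDegree ≤ d
  irreducible : IsIrreducible W
  closed : IsClosed W
  critical : W ⊆ criticalSet (fun i => 1 / (Q (some i) : ℂ)) (cauchyEntry Q)
      (Polynomial.Chebyshev.T ℂ (d : ℤ)) ε P g
  not_const : ¬ ∃ t₀ : ℂ, ∀ p ∈ W, p.t = t₀

namespace IsCurve

section

variable {K : Type} [Field K] [Algebra ℂ K] {φ : MvPolynomial (Vars n ι) ℂ →ₐ[ℂ] K}

theorem transcendental (hW : IsCurve Q d ε P g W)
    (hk : ∃ p ∈ W, p.lam.rep k ≠ 0) (hφ : ∀ F, φ F = 0 ↔ F ∈ chartIdeal W k) :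
    Transcendental ℂ (φ (X (Sum.inl none))) := by
  rintro ⟨p, hp, h⟩
  rw [Polynomial.aeval_algHom_apply, hφ] at h
  exact hW.not_const (exists_t_eq_of_aeval_mem hW.irreducible hp h hk)

/-- The generic point stays finite at the places over `t = 0`. -/
theorem integral (hW : IsCurve Q d ε P g W)
    (hφ : ∀ F, φ F = 0 ↔ F ∈ chartIdeal W k) (O : ValuationSubring K)
    (hO : ∀ c : ℂ, algebraMap ℂ K c ∈ O) (ht : φ (X (Sum.inl none)) ∈ O.nonunits) :
    (∀ j, φ (X (Sum.inl (some j))) ∈ O) ∧ φ (X (Sum.inr none)) ≠ 0 ∧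
      ∀ o, φ (X (Sum.inr o)) / φ (X (Sum.inr none)) ∈ O := by
  refine (isCritical_genericPoint hW.critical fun F hF => (hφ F).2 hF).mem_valuationSubring
    hW.degree_pos hW.injective hW.lt_node hW.prime hW.degree_constraint hW.degree_objective O hO ht
    (Function.ne_iff.2 ⟨k, ?_⟩)
  have h := (hφ _).2 (X_sub_one_mem_chartIdeal (W := W) (k := k))
  rw [map_sub, map_one, sub_eq_zero] at h
  rw [h]
  exact one_ne_zero

/-- The function `t` vanishes at some place of the function field. -/
theorem exists_place (hW : IsCurve Q d ε P g W)
    (hk : ∃ p ∈ W, p.lam.rep k ≠ 0) (hφ : ∀ F, φ F = 0 ↔ F ∈ chartIdeal W k) :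
    ∃ O : ValuationSubring K, (∀ c : ℂ, algebraMap ℂ K c ∈ O) ∧
      φ (X (Sum.inl none)) ∈ O.nonunits := by
  obtain ⟨O, hO, h⟩ := exists_valuationSubring_of_algebraicIndependent
    (v := fun _ : Unit => φ (X (Sum.inl none)))
    (algebraicIndependent_unique_type_iff.2 (hW.transcendental hk hφ))
  exact ⟨O, hO, h ()⟩

/-- The function field is algebraic over `ℂ(t)`: by `integral`, the coordinates have no poles at the
places over `t = 0`. -/
theorem isAlgebraic (hW : IsCurve Q d ε P g W)
    (hk : ∃ p ∈ W, p.lam.rep k ≠ 0) (hφ : ∀ F, φ F = 0 ↔ F ∈ chartIdeal W k)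
    (hsurj : ∀ z, ∃ F H, z = φ F / φ H) :
    Algebra.IsAlgebraic (Algebra.adjoin ℂ {φ (X (Sum.inl none))}) K := by
  have key := fun u => isAlgebraic_of_forall_mem_valuationSubring (u := u)
    (hW.transcendental hk hφ)
  have hX : ∀ i, IsAlgebraic (Algebra.adjoin ℂ {φ (X (Sum.inl none))}) (φ (X i)) := by
    rintro ((_ | j) | o)
    · exact isAlgebraic_algebraMap
        (⟨_, Algebra.subset_adjoin rfl⟩ : Algebra.adjoin ℂ {φ (X (Sum.inl none))})
    · exact key _ fun O hO ht => (hW.integral hφ O hO ht).1 j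
    · obtain ⟨O, hO, ht⟩ := hW.exists_place hk hφ
      have h0 := (hW.integral hφ O hO ht).2.1
      have h1 : φ (X (Sum.inr k)) = 1 := by
        have h := (hφ _).2 (X_sub_one_mem_chartIdeal (W := W) (k := k))
        rwa [map_sub, map_one, sub_eq_zero] at h
      have h2 := fun o => key (φ (X (Sum.inr o)) / φ (X (Sum.inr none)))
        fun O hO ht => (hW.integral hφ O hO ht).2.2 o
      -- In this chart `λ_k = 1`, so that `λ_o = (λ_o / λ_0) / (λ_k / λ_0)`.
      have h3 := (h2 o).mul (h2 k).inv
      rwa [h1, one_div, inv_inv, div_mul_cancel₀ _ h0] at h3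
  have hF : ∀ F, IsAlgebraic (Algebra.adjoin ℂ {φ (X (Sum.inl none))}) (φ F) := by
    intro F
    induction F using MvPolynomial.induction_on with
    | C c => exact isAlgebraic_algebraMap (⟨φ (C c), by
        rw [show φ (C c) = algebraMap ℂ K c from φ.commutes c]
        exact Subalgebra.algebraMap_mem _ c⟩ : Algebra.adjoin ℂ {φ (X (Sum.inl none))})
    | add F G hF hG =>
      rw [map_add]
      exact hF.add hG
    | mul_X F i hF =>
      rw [map_mul]
      exact hF.mul (hX i)
  refine ⟨fun z => ?_⟩
  obtain ⟨F, H, rfl⟩ := hsurj z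
  rw [div_eq_mul_inv]
  exact (hF F).mul (hF H).inv

end

theorem exists_eq_singleton (hW : IsCurve Q d ε P g W)
    {Z : Set (MixedSpace n ι)} (hZ : IsIrreducible Z) (hZc : IsClosed Z)
    (hZW : Z ⊆ W) (hne : Z ≠ W) : ∃ p, Z = {p} := by
  refine MixedSpace.exists_eq_singleton hW.irreducible (fun k hk i f hf => ?_) hZ hZc hZW hne
  obtain ⟨K, _, _, φ, hφ, hsurj⟩ := exists_genericPoint hW.irreducible hk
  have := hW.isAlgebraic hk hφ hsurj
  obtain ⟨R, hR0, hR⟩ := exists_relation (t := φ (X (Sum.inl none))) (φ (X i)) (f := φ f)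
    (by rwa [Ne, hφ])
  refine ⟨R, hR0, (hφ _).1 ?_⟩
  have h1 := Polynomial.hom_eval₂ R
    (Polynomial.aeval (X i) : Polynomial ℂ →ₐ[ℂ] MvPolynomial (Vars n ι) ℂ).toRingHom
    (φ : MvPolynomial (Vars n ι) ℂ →+* K) f
  have h2 : (φ : MvPolynomial (Vars n ι) ℂ →+* K).comp
      (Polynomial.aeval (X i) : Polynomial ℂ →ₐ[ℂ] MvPolynomial (Vars n ι) ℂ).toRingHom =
      (Polynomial.aeval (φ (X i)) : Polynomial ℂ →ₐ[ℂ] K).toRingHom :=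
    RingHom.ext fun p => (Polynomial.aeval_algHom_apply φ (X i) p).symm
  rw [h2] at h1
  exact h1.trans hR

/-- The generic point of `W` specializes to a point over `t = 0`, which is defined over the residue
field of a place; the Nullstellensatz provides a complex point. -/
theorem exists_t_eq_zero (hW : IsCurve Q d ε P g W) : ∃ p ∈ W, p.t = 0 := by
  obtain ⟨p₀, hp₀⟩ := hW.irreducible.nonempty
  obtain ⟨k, hk⟩ := exists_rep_ne_zero p₀
  -- `W` meets the chart `λ_0 ≠ 0`, where the coordinates of the generic point are integral.
  have hnone : ∃ p ∈ W, p.lam.rep none ≠ 0 := by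
    obtain ⟨K, _, _, φ, hφ, -⟩ := exists_genericPoint hW.irreducible ⟨p₀, hp₀, hk⟩
    obtain ⟨O, hO, ht⟩ := hW.exists_place ⟨p₀, hp₀, hk⟩ hφ
    have h0 := (hW.integral hφ O hO ht).2.1
    rw [Ne, hφ, mem_chartIdeal] at h0
    push Not at h0
    obtain ⟨p, hp, -, h⟩ := h0
    exact ⟨p, hp, fun h' => h (by simp [chart, h'])⟩
  obtain ⟨K, _, _, φ, hφ, -⟩ := exists_genericPoint hW.irreducible hnone
  obtain ⟨O, hO, ht⟩ := hW.exists_place hnone hφ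
  obtain ⟨hx, -, hl⟩ := hW.integral hφ O hO ht
  have h1 : φ (X (Sum.inr none)) = 1 := by
    have h := (hφ _).2 (X_sub_one_mem_chartIdeal (W := W) (k := none))
    rwa [map_sub, map_one, sub_eq_zero] at h
  have hφO : ∀ F, φ F ∈ O.toSubring := by
    intro F
    induction F using MvPolynomial.induction_on with
    | C c => exact (show φ (C c) = algebraMap ℂ K c from φ.commutes c) ▸ hO c
    | add F G hF hG => rw [map_add]; exact add_mem hF hG
    | mul_X F i hF =>
      rw [map_mul]
      refine mul_mem hF ?_
      rcases i with (_ | j) | o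
      · exact O.nonunits_subset ht
      · exact hx j
      · have := hl o
        rwa [h1, div_one] at this
  let φO : MvPolynomial (Vars n ι) ℂ →+* O := (φ : _ →+* K).codRestrict O.toSubring hφO
  -- The center of the place on the chart.
  set J := (IsLocalRing.maximalIdeal O).comap φO with hJ
  have hJ' : ∀ F, φ F ∈ O.nonunits → F ∈ J := fun F hF => by
    rw [hJ, Ideal.mem_comap, ← ValuationSubring.coe_mem_nonunits_iff]
    exact hF
  obtain ⟨M, hM, hJM⟩ := Ideal.exists_le_maximal J
    (Ideal.comap_ne_top _ (IsLocalRing.maximalIdeal.isMaximal O).ne_top)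
  obtain ⟨v, rfl⟩ := MvPolynomial.isMaximal_iff_eq_vanishingIdeal_singleton.1 hM
  have hv : ∀ F ∈ J, eval v F = 0 := fun F hF => by
    have := (MvPolynomial.mem_vanishingIdeal_singleton_iff v F).1 (hJM hF)
    simpa [MvPolynomial.aeval_eq_eval] using this
  obtain ⟨p, hp, hpt⟩ := exists_point_of_zero hW.closed (k := none) (v := v) fun F hF =>
    hv F (hJ' F (by rw [(hφ F).2 hF]; exact zero_mem _))
  refine ⟨p, hp, hpt.trans ?_⟩
  simpa using hv _ (hJ' _ ht)

end IsCurve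

end Core

/-! ### Irreducible components and the given system -/

namespace MixedSpace

variable {n : ℕ} {ι : Type} {A W : Set (MixedSpace n ι)}

theorem maximal_of_mem_components (hW : W ∈ components A) :
    Maximal (fun Z => IsIrreducible Z ∧ Z ⊆ A) W := hW

theorem isClosed_of_mem_components (hA : IsClosed A) (hW : W ∈ components A) : IsClosed W := by
  have hmax := maximal_of_mem_components hW
  have h : IsIrreducible (closure W) ∧ closure W ⊆ A :=
    ⟨isIrreducible_iff_closure.2 hmax.prop.1, closure_minimal hmax.prop.2 hA⟩
  exact closure_subset_iff_isClosed.1 (hmax.2 h subset_closure)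

theorem finite_components [Finite ι] (hA : IsClosed A) : (components A).Finite := by
  obtain ⟨S, hS, hSc, hSi, rfl⟩ :=
    TopologicalSpace.NoetherianSpace.exists_finite_set_isClosed_irreducible hA
  refine hS.subset fun W hW => ?_
  have hmax := maximal_of_mem_components hW
  obtain ⟨Z, hZ, hWZ⟩ := isIrreducible_iff_sUnion_isClosed.1 hmax.prop.1 hS.toFinset
    (fun Z hZ => hSc Z (hS.mem_toFinset.1 hZ)) (by simpa using hmax.prop.2)
  rw [hS.mem_toFinset] at hZ
  rw [hWZ.antisymm (hmax.2 ⟨hSi Z hZ, Set.subset_sUnion_of_mem hZ⟩ hWZ)]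
  exact hZ

/-- The components of a union of components are the components it is made of. -/
theorem mem_of_mem_components_sUnion [Finite ι] (hA : IsClosed A)
    {𝒞 : Set (Set (MixedSpace n ι))} (h𝒞 : 𝒞 ⊆ components A) (hW : W ∈ components (⋃₀ 𝒞)) :
    W ∈ 𝒞 := by
  have hmax := maximal_of_mem_components hW
  have hfin := (finite_components hA).subset h𝒞
  obtain ⟨Z, hZ, hWZ⟩ := isIrreducible_iff_sUnion_isClosed.1 hmax.prop.1 hfin.toFinset
    (fun Z hZ => isClosed_of_mem_components hA (h𝒞 (hfin.mem_toFinset.1 hZ)))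
    (by simpa using hmax.prop.2)
  rw [hfin.mem_toFinset] at hZ
  have hZi := (maximal_of_mem_components (h𝒞 hZ)).prop.1
  rw [hWZ.antisymm (hmax.2 ⟨hZi, Set.subset_sUnion_of_mem hZ⟩ hWZ)]
  exact hZ

/-- A closed set of dimension zero is finite. -/
theorem finite_of_forall_eq_singleton [Finite ι] (hA : IsClosed A)
    (h : ∀ Z ⊆ A, IsIrreducible Z → IsClosed Z → ∃ p, Z = {p}) : A.Finite := by
  obtain ⟨S, hS, hSc, hSi, rfl⟩ :=
    TopologicalSpace.NoetherianSpace.exists_finite_set_isClosed_irreducible hA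
  refine hS.sUnion fun Z hZ => ?_
  obtain ⟨p, rfl⟩ := h Z (Set.subset_sUnion_of_mem hZ) (hSi Z hZ) (hSc Z hZ)
  exact Set.finite_singleton p

end MixedSpace

/-- The nodes are an enumeration by `Nat.nth`, which takes its junk value only on finite sets. -/
theorem infinite_primes_gt (n : ℕ) : {p : ℕ | p.Prime ∧ n + 1 < p}.Infinite := by
  rw [Set.infinite_iff_exists_gt]
  intro a
  obtain ⟨p, hp, hpp⟩ := Nat.exists_infinite_primes (max a (n + 1) + 1)
  exact ⟨p, ⟨hpp, by omega⟩, by omega⟩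

theorem q_succ_spec (n i : ℕ) : (q n (i + 1)).Prime ∧ n + 1 < q n (i + 1) :=
  Nat.nth_mem_of_infinite (infinite_primes_gt n) i

theorem q_strictMono (n : ℕ) : StrictMono (q n) := by
  refine strictMono_nat_of_lt_succ fun i => ?_
  cases i with
  | zero => exact (q_succ_spec n 0).2
  | succ i => exact Nat.nth_strictMono (infinite_primes_gt n) i.lt_succ_self

section

variable {n m d : ℕ} {f : Fin m → MvPolynomial (Fin n) ℝ} {g : MvPolynomial (Fin n) ℝ}
  {S : Finset (Fin m)} {σ : S → ℤˣ}

/-- The row nodes `q_0` and `q_i`, `i ∈ S`, of the Cauchy matrix. -/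
noncomputable def nodes (n : ℕ) (S : Finset (Fin m)) : Option S → ℕ :=
  fun o => o.elim (q n 0) fun i => q n ((i : Fin m) + 1)

theorem nodes_injective : Function.Injective (nodes n S) := by
  rintro (_ | i) (_ | j) h
  · rfl
  · exact absurd ((q_strictMono n).injective (a₁ := 0) (a₂ := (j : Fin m) + 1) h)
      (Nat.succ_ne_zero _).symm
  · exact absurd ((q_strictMono n).injective (a₁ := (i : Fin m) + 1) (a₂ := 0) h)
      (Nat.succ_ne_zero _)
  · have := (q_strictMono n).injective (a₁ := (i : Fin m) + 1) (a₂ := (j : Fin m) + 1) h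
    rw [Subtype.ext (Fin.ext (Nat.succ_injective this))]

theorem lt_nodes (o : Option S) : n < nodes n S o := by
  cases o with
  | none => exact Nat.lt_succ_self n
  | some i => exact (Nat.lt_succ_self n).trans (q_succ_spec n _).2

theorem eval_map_chebyshevVar (x : Fin n → ℂ) (j : Fin n) :
    MvPolynomial.eval x (MvPolynomial.map (algebraMap ℝ ℂ) (chebyshevVar n d j)) =
      Polynomial.aeval (x j) (Polynomial.Chebyshev.T ℂ (d : ℤ)) := by
  rw [MvPolynomial.eval_map, ← MvPolynomial.aeval_def, chebyshevVar,
    ← Polynomial.aeval_algHom_apply, MvPolynomial.aeval_X, Polynomial.Chebyshev.aeval_T,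
    Polynomial.Chebyshev.aeval_T]

theorem pderiv_chebyshevVar (i j : Fin n) : MvPolynomial.pderiv i (chebyshevVar n d j) =
    if j = i then (d : MvPolynomial (Fin n) ℝ) * Polynomial.aeval (MvPolynomial.X j)
      (Polynomial.Chebyshev.U ℝ ((d : ℤ) - 1)) else 0 := by
  rw [chebyshevVar, Derivation.map_aeval, Polynomial.Chebyshev.T_derivative_eq_U]
  split_ifs with h
  · subst h
    simp
  · simp [MvPolynomial.pderiv_X_of_ne h]

theorem eval_map_pderiv_chebyshevVar (x : Fin n → ℂ) (i j : Fin n) :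
    MvPolynomial.eval x (MvPolynomial.map (algebraMap ℝ ℂ)
      (MvPolynomial.pderiv i (chebyshevVar n d j))) =
      if j = i then Polynomial.aeval (x i) (Polynomial.Chebyshev.T ℂ (d : ℤ)).derivative
      else 0 := by
  rw [pderiv_chebyshevVar]
  split_ifs with h
  · subst h
    rw [Polynomial.Chebyshev.T_derivative_eq_U, MvPolynomial.eval_map, ← MvPolynomial.aeval_def,
      map_mul, map_mul, ← Polynomial.aeval_algHom_apply, MvPolynomial.aeval_X,
      Polynomial.Chebyshev.aeval_U, Polynomial.Chebyshev.aeval_U]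
    simp
  · simp

theorem totalDegree_map_le (p : MvPolynomial (Fin n) ℝ) :
    (MvPolynomial.map (algebraMap ℝ ℂ) p).totalDegree ≤ p.totalDegree :=
  Finset.sup_mono (MvPolynomial.support_map_subset _ _)

theorem eval_map_gTilde_pderiv (x : Fin n → ℂ) (j : Fin n) :
    MvPolynomial.eval x (MvPolynomial.map (algebraMap ℝ ℂ)
      (MvPolynomial.pderiv j (gTilde m n d))) = cauchyEntry (nodes n S) none j *
        Polynomial.aeval (x j) (Polynomial.Chebyshev.T ℂ (d : ℤ)).derivative := by
  simp only [gTilde, map_sum, Derivation.leibniz, MvPolynomial.pderiv_C, smul_eq_mul, mul_zero,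
    add_zero, map_mul, eval_map_pderiv_chebyshevVar, mul_ite, Finset.sum_ite_eq', Finset.mem_univ,
    if_true, MvPolynomial.map_C, MvPolynomial.eval_C]
  simp [cauchyMatrix, cauchyEntry, nodes]

theorem eval_map_fTilde_pderiv (x : Fin n → ℂ) (i : S) (j : Fin n) :
    MvPolynomial.eval x (MvPolynomial.map (algebraMap ℝ ℂ)
      (MvPolynomial.pderiv j (fTilde m n d i))) = cauchyEntry (nodes n S) (some i) j *
        Polynomial.aeval (x j) (Polynomial.Chebyshev.T ℂ (d : ℤ)).derivative := by
  simp only [fTilde, map_add, map_sum, Derivation.leibniz, MvPolynomial.pderiv_C, smul_eq_mul,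
    mul_zero, add_zero, zero_add, map_mul, eval_map_pderiv_chebyshevVar, mul_ite,
    Derivation.map_one_eq_zero,
    Finset.sum_ite_eq', Finset.mem_univ, if_true, MvPolynomial.map_C, MvPolynomial.eval_C]
  simp [cauchyMatrix, cauchyEntry, nodes]

theorem eval_map_fTilde (x : Fin n → ℂ) (i : S) :
    MvPolynomial.eval x (MvPolynomial.map (algebraMap ℝ ℂ) (fTilde m n d i)) =
      1 / (nodes n S (some i) : ℂ) + ∑ j, cauchyEntry (nodes n S) (some i) j *
        (Polynomial.aeval (x j) (Polynomial.Chebyshev.T ℂ (d : ℤ)) + 1) := by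
  simp only [fTilde, map_add, map_sum, map_mul, map_one, eval_map_chebyshevVar,
    MvPolynomial.map_C, MvPolynomial.eval_C]
  simp [cauchyMatrix, cauchyEntry, nodes]

/-- The variety `V̂_{S,σ}` in terms of the critical point equations over `ℂ`. -/
theorem VHat_eq : VHat d f g S σ = criticalSet (fun i => 1 / (nodes n S (some i) : ℂ))
    (cauchyEntry (nodes n S)) (Polynomial.Chebyshev.T ℂ (d : ℤ)) σ
    (fun i => MvPolynomial.map (algebraMap ℝ ℂ) (f i)) (MvPolynomial.map (algebraMap ℝ ℂ) g) := by
  have hc : ∀ (ε : ℤˣ) (p pT : MvPolynomial (Fin n) ℝ) (t : ℂ) (x : Fin n → ℂ),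
      MvPolynomial.eval x (deform ε p pT t) =
        t * MvPolynomial.eval x (MvPolynomial.map (algebraMap ℝ ℂ) p) + ((ε : ℤ) : ℂ) * (1 - t) *
          MvPolynomial.eval x (MvPolynomial.map (algebraMap ℝ ℂ) pT) := by
    intro ε p pT t x
    simp [deform]
  have hs : ∀ (ε : ℤˣ) (p pT : MvPolynomial (Fin n) ℝ) (t : ℂ) (x : Fin n → ℂ) (j : Fin n),
      MvPolynomial.eval x (MvPolynomial.pderiv j (deform ε p pT t)) =
        t * MvPolynomial.eval x (MvPolynomial.pderiv j (MvPolynomial.map (algebraMap ℝ ℂ) p)) +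
          ((ε : ℤ) : ℂ) * (1 - t) * MvPolynomial.eval x
            (MvPolynomial.map (algebraMap ℝ ℂ) (MvPolynomial.pderiv j pT)) := by
    intro ε p pT t x j
    simp [deform, MvPolynomial.pderiv_map]
  ext p
  constructor
  · rintro ⟨h1, h2⟩
    refine ⟨fun i => ?_, fun j => ?_⟩
    · have := h1 i
      rw [F, hc, eval_map_fTilde] at this
      exact this
    · have := h2 j
      simp only [F, G, hs, eval_map_fTilde_pderiv, eval_map_gTilde_pderiv (S := S),
        Units.val_one, Int.cast_one, one_mul] at this
      exact this
  · intro h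
    refine ⟨fun i => ?_, fun j => ?_⟩
    · rw [F, hc, eval_map_fTilde]
      exact h.constraint i
    · simp only [F, G, hs, eval_map_fTilde_pderiv, eval_map_gTilde_pderiv (S := S),
        Units.val_one, Int.cast_one, one_mul]
      exact h.stationary j

theorem isCurve (hd : 0 < d) (hf : ∀ i, (f i).totalDegree ≤ d) (hg : g.totalDegree ≤ d)
    {W : Set (MixedSpace n S)} (hW : W ∈ MixedSpace.components (VHat d f g S σ))
    (ht : ¬ ∃ t₀ : ℂ, ∀ p ∈ W, p.t = t₀) :
    IsCurve (nodes n S) d σ (fun i => MvPolynomial.map (algebraMap ℝ ℂ) (f i))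
      (MvPolynomial.map (algebraMap ℝ ℂ) g) W where
  degree_pos := hd
  injective := nodes_injective
  lt_node := lt_nodes
  prime _ := (q_succ_spec n _).1
  degree_constraint i := (totalDegree_map_le _).trans (hf i)
  degree_objective := (totalDegree_map_le _).trans hg
  irreducible := (MixedSpace.maximal_of_mem_components hW).prop.1
  closed := MixedSpace.isClosed_of_mem_components (VHat_eq ▸ isClosed_criticalSet) hW
  critical := VHat_eq ▸ (MixedSpace.maximal_of_mem_components hW).prop.2
  not_const := ht

end

end Deformation

theorem mainTheorem3 (n m l d : ℕ) (hn : 2 ≤ n) (hl : l ≤ m) (hd : 0 < d) (hd2 : Even d)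
    (f : Fin m → MvPolynomial (Fin n) ℝ) (g : MvPolynomial (Fin n) ℝ)
    (hf : ∀ i, (f i).totalDegree ≤ d) (hg : g.totalDegree ≤ d)
    (S : Finset (Fin m)) (σ : S → ℤˣ)
    (hSσ : (⟨S, σ⟩ : Σ S : Finset (Fin m), S → ℤˣ) ∈ Deformation.indexSet n m l) :
    (∀ W ∈ Deformation.MixedSpace.components (Deformation.V d f g S σ),
      topologicalKrullDim W = 1 ∧ ∃ p ∈ W, p.t = 0) ∧
    (Deformation.MixedSpace.x '' (Deformation.V d f g S σ ∩ {p | p.t = 1})).Finite := by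
  have hclosed : IsClosed (Deformation.VHat d f g S σ) :=
    Deformation.VHat_eq ▸ Deformation.isClosed_criticalSet
  constructor
  · intro W hW
    obtain ⟨hWc, ht⟩ := Deformation.MixedSpace.mem_of_mem_components_sUnion hclosed
      (Set.sep_subset _ _) hW
    have hcurve := Deformation.isCurve hd hf hg hWc ht
    refine ⟨Deformation.MixedSpace.topologicalKrullDim_eq_one hcurve.closed
      (fun Z hZ hZc hZW hne => hcurve.exists_eq_singleton hZ hZc hZW hne) hcurve.irreducible ?_,
      hcurve.exists_t_eq_zero⟩
    refine Set.not_subsingleton_iff.1 fun hsub => ht ?_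
    obtain ⟨p, hp⟩ := hcurve.irreducible.nonempty
    exact ⟨p.t, fun r hr => by rw [hsub hr hp]⟩
  · refine Set.Finite.image _ ?_
    rw [Deformation.V, Set.sUnion_eq_biUnion, Set.iUnion₂_inter]
    refine Set.Finite.biUnion
      ((Deformation.MixedSpace.finite_components hclosed).subset (Set.sep_subset _ _)) ?_
    rintro W ⟨hWc, ht⟩
    have hcurve := Deformation.isCurve hd hf hg hWc ht
    refine Deformation.MixedSpace.finite_of_forall_eq_singleton
      (hcurve.closed.inter (Deformation.MixedSpace.isClosed_t_eq 1)) fun Z hZ hZi hZc => ?_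
    refine hcurve.exists_eq_singleton hZi hZc (fun p hp => (hZ hp).1) fun hZW => ht ⟨1, ?_⟩
    exact fun p hp => (hZ (hZW ▸ hp)).2
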